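/- Let $\mathbf{C}$ be a symmetric monoidal category (for instance a symmetric strict one, with symmetry $\gamma$) enriched over complexes of $\mathbb{C}$-vector spaces concentrated in degrees $-1,0$, and let $t:\otimes\Rightarrow\otimes$ be an infinitesimal 2-braiding (a pseudonatural endomorphism of $\otimes$, with components $t_{X,Y}$ and homotopies $t_{f\boxtimes g}$) which is symmetric, $t=\gamma^{-1}t_\tau\gamma$, and strict, $t_{1(23)}=t_{12}+t_{13}$ and $t_{(12)3}=t_{23}+t_{13}$. Here $t_{12},t_{23},t_{13},t_{1(23)},t_{(12)3}$ are the induced pseudonatural endomorphisms of $\otimes^2:\mathbf{C}^{\boxtimes3}\to\mathbf{C}$. Let $\mathcal{L},\mathcal{R}$ be the four-term relationators, i.e. the modifications with components $\mathcal{L}_{XYZ}=t_{t_{X,Y}\boxtimes 1_Z}$ and $\mathcal{R}_{XYZ}=t_{1_X\boxtimes t_{Y,Z}}$. Put $\Lambda=t_{12}+t_{23}+t_{13}$ and $\overline{t_{13}}=t_{13}-\Lambda$. Pseudonatural endomorphisms of $\otimes^2$ form an algebra under composition, which acts on (components of) modifications from the left and from the right by whiskering; $\mathrm{ad}_x m=xm-mx$.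 On $(\mathbb{C}\setminus\{0,1\})\times(\mathbb{C}\setminus\{0\})$ with coordinates $(z,v)$ consider $$\nabla=\Gamma+\frac{\Lambda}{v}\,dv,\qquad \Gamma=\Big(\frac{t_{12}}{z}+\frac{t_{23}}{z-1}\Big)dz,\qquad \Delta=2\Big(\frac{\mathcal{L}}{zv}+\frac{\mathcal{R}}{(z-1)v}\Big)dz\wedge dv,$$ where $(dz\wedge dv)[X,Y]=\tfrac12(X_zY_v-X_vY_z)$. For a piecewise smooth path $p$ let $W^p_{r'r}$ be the parallel transport of $\hbar\nabla$ along $p$ from time $r$ to time $r'$, i.e. the formal power series in $\hbar$ with $W^p_{rr}=1$, $\frac{d}{dr'}W^p_{r'r}=\hbar\nabla[\dot p(r')]\,W^p_{r'r}$, and for a path $c$ in $\mathbb{C}\setminus\{0,1\}$ let $W^c$ be the parallel transport of $\hbar\Gamma$ along $c$ from $0$ to $1$. For a piecewise smooth family of paths $\mathcal{P}(s,r)=\mathcal{P}^s(r)$ with fixed endpoints, the 2-holonomy is the modification with components $$W^{\mathcal{P}}=\int_0^1\!\!\int_0^1W^{\mathcal{P}^s}_{1r}\,\hbar^2\Delta\Big[\frac{\partial\mathcal{P}}{\partial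 s},\frac{\partial\mathcal{P}}{\partial r}\Big]W^{\mathcal{P}^s}_{r0}\,dr\,ds .$$ Let $0<\varepsilon\le\frac14$, $a\in\mathbb{C}\setminus\{0\}$, $c_{\mathbf I}(s)=\varepsilon+s(1-2\varepsilon)$, $z(s)=(c_{\mathbf V}\circ\iota)(s)=1-\frac{1}{1-c_{\mathbf I}(s)}$, $p_\leftarrow(r)=(z(2r),a)$, $p_{\mathbf V}(r)=\big(z(r),\frac{1-c_{\mathbf I}(r)}{1-\varepsilon}a\big)$, and let $\mathcal{P}_{\mathbf V}$ be the first vertically-interpolative 2-path $$\mathcal{P}_{\mathbf V}(s,r)=\begin{cases}p_\leftarrow(r),&0\le r\le\frac s2,\\ \big(z(s),\tfrac{1-c_{\mathbf I}(2r-s)}{1-\varepsilon}a\big),&\frac s2\le r\le s,\\ p_{\mathbf V}(r),&s\le r\le1.\end{cases}$$ Let $\Omega_0=\frac{ds}{s}$, $\Omega_1=\frac{ds}{s-1}$, let $\int_\alpha^\beta\omega_1\cdots\omega_n=\int_\alpha^\beta\omega_1(s)\int_\alpha^s\omega_2\cdots\omega_n$ denote iterated integrals, put $T_0=\mathrm{ad}_{t_{12}}$,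 $T_1=\mathrm{ad}_{\overline{t_{13}}}+\Lambda$ ($\Lambda$ acting from the left), and $$f_{\mathbf V}(s)=\sum_{r\ge0,\,k\ge1}\hbar^{r+k+1}\sum_{i_1,\dots,i_r\in\{0,1\}}\sum_{j=0}^{k-1}T_{i_1}\cdots T_{i_r}\Lambda^j\Big[\int_\varepsilon^{c_{\mathbf I}(s)}\!\Omega_{i_1}\cdots\Omega_{i_r}\Omega_0\Omega_1^k\;\mathcal{L}-\int_\varepsilon^{c_{\mathbf I}(s)}\!\Omega_{i_1}\cdots\Omega_{i_r}\Omega_1^{k+1}\;(\mathcal{L}+\mathcal{R})\Big]\Lambda^{k-1-j}.$$ Then the integrals defining $W^{\mathcal{P}_{\mathbf V}}$ exist; $f_{\mathbf V}(0)=0$ and $f_{\mathbf V}$ solves, for $s\in[0,1]$, the first-order formal ODE $$\frac{d}{ds}\Big[\big(W^{p_{\mathbf V}}_{s0}\big)^{-1}f_{\mathbf V}\,W^{p_\leftarrow}_{\frac s2 0}\Big]=\frac{dz}{ds}\big(W^{p_{\mathbf V}}_{s0}\big)^{-1}\sum_{k\ge1}\hbar^{k+1}\frac{1}{k!}\Big[\ln\frac{1-c_{\mathbf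 I}(s)}{1-\varepsilon}\Big]^k\sum_{j=0}^{k-1}\Lambda^j\Big[\frac{\mathcal{L}}{z}+\frac{\mathcal{R}}{z-1}\Big]\Lambda^{k-1-j}\;W^{p_\leftarrow}_{\frac s2 0};$$ and $$W^{\mathcal{P}_{\mathbf V}}=f_{\mathbf V}(1)\,W^{c_{\mathbf V}\circ\iota}.$$ -/

import Mathlib

open CategoryTheory MonoidalCategory

universe v u w

set_option linter.unusedSectionVars false
set_option linter.unnecessarySeqFocus false

/-! ## Categories enriched over two-term cochain complexes -/

/-- A `ℂ`-linear category `C` becomes a category enriched over cochain complexes concentrated in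
degrees `-1` and `0`: the morphisms `X ⟶ Y` are the degree `0` part of the hom-complex, `H X Y` is
the degree `-1` part, `d` is the differential, `post k g` is the composite `g k` and `pre f k` is
the composite `k f`.  There is nothing in degree `-2`, so `(d l) k = l (d k)`. -/
class ChCategory (C : Type u) [Category.{v} C] [Preadditive C] [Linear ℂ C] where
  H : C → C → Type w
  [addCommGroup : ∀ X Y, AddCommGroup (H X Y)]
  [module : ∀ X Y, Module ℂ (H X Y)]
  d : ∀ {X Y : C}, H X Y →ₗ[ℂ] (X ⟶ Y)
  post : ∀ {X Y Z : C}, H X Y →ₗ[ℂ] (Y ⟶ Z) →ₗ[ℂ] H X Z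
  pre : ∀ {X Y Z : C}, (X ⟶ Y) →ₗ[ℂ] H Y Z →ₗ[ℂ] H X Z
  post_id : ∀ {X Y : C} (k : H X Y), post k (𝟙 Y) = k
  pre_id : ∀ {X Y : C} (k : H X Y), pre (𝟙 X) k = k
  post_post : ∀ {X Y Z T : C} (k : H X Y) (g : Y ⟶ Z) (h : Z ⟶ T),
    post (post k g) h = post k (g ≫ h)
  pre_pre : ∀ {X Y Z T : C} (f : X ⟶ Y) (g : Y ⟶ Z) (k : H Z T),
    pre f (pre g k) = pre (f ≫ g) k
  pre_post : ∀ {X Y Z T : C} (f : X ⟶ Y) (k : H Y Z) (g : Z ⟶ T),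
    pre f (post k g) = post (pre f k) g
  d_post : ∀ {X Y Z : C} (k : H X Y) (g : Y ⟶ Z), d (post k g) = d k ≫ g
  d_pre : ∀ {X Y Z : C} (f : X ⟶ Y) (k : H Y Z), d (pre f k) = f ≫ d k
  post_d : ∀ {X Y Z : C} (k : H X Y) (l : H Y Z), post k (d l) = pre (d k) l

attribute [reducible] ChCategory.addCommGroup ChCategory.module
attribute [instance] ChCategory.addCommGroup ChCategory.module

open ChCategory

/-- A symmetric monoidal structure on `C` compatible with the enrichment: the monoidal product is
an enriched functor on the (truncated) tensor square of `C`, with `tensL k g = k ⊗ g` and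
`tensR f l = f ⊗ l` for `k`, `l` of degree `-1`, and the structural isomorphisms are natural in all
degrees.  The strict case is the one in which `α`, `λ` and `ρ` are identities. -/
class ChSymmetricMonoidal (C : Type u) [Category.{v} C] [Preadditive C] [Linear ℂ C]
    [ChCategory.{v, u, w} C] [MonoidalCategory C] [MonoidalPreadditive C] [MonoidalLinear ℂ C]
    [SymmetricCategory C] where
  tensL : ∀ {X X' Y Y' : C}, H X X' →ₗ[ℂ] (Y ⟶ Y') →ₗ[ℂ] H (X ⊗ Y) (X' ⊗ Y')
  tensR : ∀ {X X' Y Y' : C}, (X ⟶ X') →ₗ[ℂ] H Y Y' →ₗ[ℂ] H (X ⊗ Y) (X' ⊗ Y')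
  d_tensL : ∀ {X X' Y Y' : C} (k : H X X') (g : Y ⟶ Y'), d (tensL k g) = d k ⊗ₘ g
  d_tensR : ∀ {X X' Y Y' : C} (f : X ⟶ X') (l : H Y Y'), d (tensR f l) = f ⊗ₘ d l
  tens_d : ∀ {X X' Y Y' : C} (k : H X X') (l : H Y Y'), tensL k (d l) = tensR (d k) l
  tensL_post : ∀ {X X' X'' Y Y' Y'' : C} (k : H X X') (f : X' ⟶ X'') (g : Y ⟶ Y')
    (g' : Y' ⟶ Y''), tensL (post k f) (g ≫ g') = post (tensL k g) (f ⊗ₘ g')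
  tensL_pre : ∀ {X X' X'' Y Y' Y'' : C} (f : X ⟶ X') (k : H X' X'') (g : Y ⟶ Y')
    (g' : Y' ⟶ Y''), tensL (pre f k) (g ≫ g') = pre (f ⊗ₘ g) (tensL k g')
  tensR_post : ∀ {X X' X'' Y Y' Y'' : C} (f : X ⟶ X') (f' : X' ⟶ X'') (l : H Y Y')
    (g : Y' ⟶ Y''), tensR (f ≫ f') (post l g) = post (tensR f l) (f' ⊗ₘ g)
  tensR_pre : ∀ {X X' X'' Y Y' Y'' : C} (f : X ⟶ X') (f' : X' ⟶ X'') (g : Y ⟶ Y')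
    (l : H Y' Y''), tensR (f ≫ f') (pre g l) = pre (f ⊗ₘ g) (tensR f' l)
  assoc_left : ∀ {X X' Y Y' Z Z' : C} (k : H X X') (g : Y ⟶ Y') (h : Z ⟶ Z'),
    post (tensL (tensL k g) h) (α_ X' Y' Z').hom = pre (α_ X Y Z).hom (tensL k (g ⊗ₘ h))
  assoc_middle : ∀ {X X' Y Y' Z Z' : C} (f : X ⟶ X') (k : H Y Y') (h : Z ⟶ Z'),
    post (tensL (tensR f k) h) (α_ X' Y' Z').hom = pre (α_ X Y Z).hom (tensR f (tensL k h))
  assoc_right : ∀ {X X' Y Y' Z Z' : C} (f : X ⟶ X') (g : Y ⟶ Y') (k : H Z Z'),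
    post (tensR (f ⊗ₘ g) k) (α_ X' Y' Z').hom = pre (α_ X Y Z).hom (tensR f (tensR g k))
  left_unit : ∀ {X X' : C} (k : H X X'),
    post (tensR (𝟙 (𝟙_ C)) k) (λ_ X').hom = pre (λ_ X).hom k
  right_unit : ∀ {X X' : C} (k : H X X'),
    post (tensL k (𝟙 (𝟙_ C))) (ρ_ X').hom = pre (ρ_ X).hom k
  braid_left : ∀ {X X' Y Y' : C} (k : H X X') (g : Y ⟶ Y'),
    post (tensL k g) (β_ X' Y').hom = pre (β_ X Y).hom (tensR g k)
  braid_right : ∀ {X X' Y Y' : C} (f : X ⟶ X') (l : H Y Y'),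
    post (tensR f l) (β_ X' Y').hom = pre (β_ X Y).hom (tensL l f)

open ChSymmetricMonoidal

/-- The generators of the formal KZ 2-connection: elements `t₁₂`, `t₂₃`, `t₁₃` of an algebra `A` and
`L`, `R` of an `A`-bimodule `M`. -/
structure KZGenerators (A M : Type*) where
  t12 : A
  t23 : A
  t13 : A
  L : M
  R : M

section Categorical

variable (C : Type u) [Category.{v} C] [Preadditive C] [Linear ℂ C]
  [ChCategory.{v, u, w} C] [MonoidalCategory C] [MonoidalPreadditive C] [MonoidalLinear ℂ C]
  [SymmetricCategory C] [ChSymmetricMonoidal C]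

/-- An infinitesimal 2-braiding: a pseudonatural endomorphism of `⊗ : C ⊠ C → C`.  The homotopy
component `t_{f ⊠ g}` is linear on the tensor product of the hom-spaces, i.e. bilinear in
`(f, g)`. -/
structure Inf2Braiding where
  app : ∀ X Y : C, X ⊗ Y ⟶ X ⊗ Y
  htpy : ∀ {X X' Y Y' : C}, (X ⟶ X') →ₗ[ℂ] (Y ⟶ Y') →ₗ[ℂ] H (X ⊗ Y) (X' ⊗ Y')
  d_htpy : ∀ {X X' Y Y' : C} (f : X ⟶ X') (g : Y ⟶ Y'),
    app X Y ≫ (f ⊗ₘ g) - (f ⊗ₘ g) ≫ app X' Y' = d (htpy f g)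
  htpy_d_left : ∀ {X X' Y Y' : C} (k : H X X') (g : Y ⟶ Y'),
    pre (app X Y) (tensL k g) - post (tensL k g) (app X' Y') = htpy (d k) g
  htpy_d_right : ∀ {X X' Y Y' : C} (f : X ⟶ X') (l : H Y Y'),
    pre (app X Y) (tensR f l) - post (tensR f l) (app X' Y') = htpy f (d l)
  htpy_comp : ∀ {X X' X'' Y Y' Y'' : C} (f : X ⟶ X') (f' : X' ⟶ X'') (g : Y ⟶ Y')
    (g' : Y' ⟶ Y''),
    htpy (f ≫ f') (g ≫ g') = pre (f ⊗ₘ g) (htpy f' g') + post (htpy f g) (f' ⊗ₘ g')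

/-- The components of a would-be pseudonatural endomorphism of
`⊗² : C ⊠ C ⊠ C → C`, `(X, Y, Z) ↦ X ⊗ (Y ⊗ Z)`: a degree `0` morphism for every triple of objects
and a degree `-1` morphism for every triple of morphisms. -/
abbrev PsNatData : Type max u v w :=
  (∀ X Y Z : C, X ⊗ (Y ⊗ Z) ⟶ X ⊗ (Y ⊗ Z)) ×
  (∀ X X' Y Y' Z Z' : C, (X ⟶ X') → (Y ⟶ Y') → (Z ⟶ Z') →
    H (X ⊗ (Y ⊗ Z)) (X' ⊗ (Y' ⊗ Z')))

variable {C}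

/-- The component at a triple of objects. -/
abbrev PsNatData.app (ξ : PsNatData C) (X Y Z : C) : X ⊗ (Y ⊗ Z) ⟶ X ⊗ (Y ⊗ Z) := ξ.1 X Y Z

/-- The homotopy component at a triple of morphisms. -/
abbrev PsNatData.htpy (ξ : PsNatData C) {X X' Y Y' Z Z' : C} (f : X ⟶ X') (g : Y ⟶ Y')
    (h : Z ⟶ Z') : H (X ⊗ (Y ⊗ Z)) (X' ⊗ (Y' ⊗ Z')) := ξ.2 X X' Y Y' Z Z' f g h

/-- The axioms of a pseudonatural endomorphism of `⊗²`. -/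
structure IsPsNat (ξ : PsNatData C) : Prop where
  add_left : ∀ {X X' Y Y' Z Z' : C} (f f' : X ⟶ X') (g : Y ⟶ Y') (h : Z ⟶ Z'),
    ξ.htpy (f + f') g h = ξ.htpy f g h + ξ.htpy f' g h
  add_middle : ∀ {X X' Y Y' Z Z' : C} (f : X ⟶ X') (g g' : Y ⟶ Y') (h : Z ⟶ Z'),
    ξ.htpy f (g + g') h = ξ.htpy f g h + ξ.htpy f g' h
  add_right : ∀ {X X' Y Y' Z Z' : C} (f : X ⟶ X') (g : Y ⟶ Y') (h h' : Z ⟶ Z'),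
    ξ.htpy f g (h + h') = ξ.htpy f g h + ξ.htpy f g h'
  smul_left : ∀ {X X' Y Y' Z Z' : C} (c : ℂ) (f : X ⟶ X') (g : Y ⟶ Y') (h : Z ⟶ Z'),
    ξ.htpy (c • f) g h = c • ξ.htpy f g h
  smul_middle : ∀ {X X' Y Y' Z Z' : C} (c : ℂ) (f : X ⟶ X') (g : Y ⟶ Y') (h : Z ⟶ Z'),
    ξ.htpy f (c • g) h = c • ξ.htpy f g h
  smul_right : ∀ {X X' Y Y' Z Z' : C} (c : ℂ) (f : X ⟶ X') (g : Y ⟶ Y') (h : Z ⟶ Z'),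
    ξ.htpy f g (c • h) = c • ξ.htpy f g h
  d_htpy : ∀ {X X' Y Y' Z Z' : C} (f : X ⟶ X') (g : Y ⟶ Y') (h : Z ⟶ Z'),
    ξ.app X Y Z ≫ (f ⊗ₘ (g ⊗ₘ h)) - (f ⊗ₘ (g ⊗ₘ h)) ≫ ξ.app X' Y' Z' = d (ξ.htpy f g h)
  htpy_d_left : ∀ {X X' Y Y' Z Z' : C} (k : H X X') (g : Y ⟶ Y') (h : Z ⟶ Z'),
    pre (ξ.app X Y Z) (tensL k (g ⊗ₘ h)) - post (tensL k (g ⊗ₘ h)) (ξ.app X' Y' Z')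
      = ξ.htpy (d k) g h
  htpy_d_middle : ∀ {X X' Y Y' Z Z' : C} (f : X ⟶ X') (k : H Y Y') (h : Z ⟶ Z'),
    pre (ξ.app X Y Z) (tensR f (tensL k h)) - post (tensR f (tensL k h)) (ξ.app X' Y' Z')
      = ξ.htpy f (d k) h
  htpy_d_right : ∀ {X X' Y Y' Z Z' : C} (f : X ⟶ X') (g : Y ⟶ Y') (k : H Z Z'),
    pre (ξ.app X Y Z) (tensR f (tensR g k)) - post (tensR f (tensR g k)) (ξ.app X' Y' Z')
      = ξ.htpy f g (d k)
  htpy_comp : ∀ {X X' X'' Y Y' Y'' Z Z' Z'' : C} (f : X ⟶ X') (f' : X' ⟶ X'')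
    (g : Y ⟶ Y') (g' : Y' ⟶ Y'') (h : Z ⟶ Z') (h' : Z' ⟶ Z''),
    ξ.htpy (f ≫ f') (g ≫ g') (h ≫ h')
      = pre (f ⊗ₘ (g ⊗ₘ h)) (ξ.htpy f' g' h') + post (ξ.htpy f g h) (f' ⊗ₘ (g' ⊗ₘ h'))

variable (C) in
/-- The space of pseudonatural endomorphisms of `⊗²`. -/
def psNat : Submodule ℂ (PsNatData C) where
  carrier := {ξ | IsPsNat ξ}
  add_mem' := by
    rintro ξ θ ⟨a1, a2, a3, b1, b2, b3, c1, c2, c3, c4, c5⟩ ⟨a1', a2', a3', b1', b2', b3', c1', c2', c3', c4', c5'⟩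
    constructor <;> intros <;>
      simp only [PsNatData.app, PsNatData.htpy, Prod.fst_add, Prod.snd_add, Pi.add_apply, map_add,
        LinearMap.add_apply, Preadditive.add_comp, Preadditive.comp_add, smul_add] at *
    · rw [a1, a1']; abel
    · rw [a2, a2']; abel
    · rw [a3, a3']; abel
    · rw [b1, b1']
    · rw [b2, b2']
    · rw [b3, b3']
    · rw [← c1, ← c1']; abel
    · rw [← c2, ← c2']; abel
    · rw [← c3, ← c3']; abel
    · rw [← c4, ← c4']; abel
    · rw [c5, c5']; abel
  zero_mem' := by
    constructor <;> intros <;>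
      simp [PsNatData.app, PsNatData.htpy]
  smul_mem' := by
    rintro c ξ ⟨a1, a2, a3, b1, b2, b3, c1, c2, c3, c4, c5⟩
    constructor <;> intros <;>
      simp only [PsNatData.app, PsNatData.htpy, Prod.smul_fst, Prod.smul_snd, Pi.smul_apply, map_smul,
        LinearMap.smul_apply, Linear.smul_comp, Linear.comp_smul, ← smul_sub, ← smul_add] at *
    · rw [a1]
    · rw [a2]
    · rw [a3]
    · rw [b1, smul_comm]
    · rw [b2, smul_comm]
    · rw [b3, smul_comm]
    · rw [← c1]
    · rw [← c2]
    · rw [← c3]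
    · rw [← c4]
    · rw [c5]

variable (C) in
/-- The pseudonatural endomorphisms of `⊗²`. -/
abbrev PsNat : Type max u v w := psNat C

/-- The vertical composite `θ ξ`: `(θ ξ)_U = θ_U ξ_U`, `(θ ξ)_f = θ_f ξ_U + θ_{U'} ξ_f`. -/
def PsNatData.comp (θ ξ : PsNatData C) : PsNatData C :=
  (fun X Y Z => ξ.app X Y Z ≫ θ.app X Y Z,
   fun X X' Y Y' Z Z' f g h =>
     pre (ξ.app X Y Z) (θ.htpy f g h) + post (ξ.htpy f g h) (θ.app X' Y' Z'))

lemma IsPsNat.comp {θ ξ : PsNatData C} (hθ : IsPsNat θ) (hξ : IsPsNat ξ) :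
    IsPsNat (θ.comp ξ) := by
  obtain ⟨a1, a2, a3, b1, b2, b3, c1, c2, c3, c4, c5⟩ := hθ
  obtain ⟨a1', a2', a3', b1', b2', b3', c1', c2', c3', c4', c5'⟩ := hξ
  constructor <;> intros <;>
    simp only [PsNatData.app, PsNatData.htpy, PsNatData.comp] at *
  · rw [a1, a1']; simp; abel
  · rw [a2, a2']; simp; abel
  · rw [a3, a3']; simp; abel
  · rw [b1, b1']; simp
  · rw [b2, b2']; simp
  · rw [b3, b3']; simp
  · rw [map_add, d_pre, d_post, ← c1, ← c1']; simp
  · rw [← c2, ← c2']; simp [pre_pre, post_post, pre_post]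
  · rw [← c3, ← c3']; simp [pre_pre, post_post, pre_post]
  · rw [← c4, ← c4']; simp [pre_pre, post_post, pre_post]
  · rename_i f f' g g' h h'
    rw [c5, c5']
    have key := post_d (ξ.2 _ _ _ _ _ _ f g h) (θ.2 _ _ _ _ _ _ f' g' h')
    rw [← c1, ← c1'] at key
    simp only [map_sub, LinearMap.sub_apply] at key
    simp only [map_add, LinearMap.add_apply, pre_pre, post_post, pre_post]
    rw [← sub_eq_zero] at key ⊢
    rw [← neg_eq_zero, ← key]
    abel

instance : Mul (PsNat C) := ⟨fun θ ξ => ⟨θ.1.comp ξ.1, θ.2.comp ξ.2⟩⟩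

/-- The identity pseudonatural transformation. -/
instance : One (PsNat C) := ⟨⟨(fun _ _ _ => 𝟙 _, 0), by
  constructor <;> intros <;> simp [PsNatData.app, PsNatData.htpy, pre_id, post_id]⟩⟩

lemma PsNat.ext' {ξ θ : PsNat C} (h₁ : ∀ X Y Z, ξ.1.1 X Y Z = θ.1.1 X Y Z)
    (h₂ : ∀ X X' Y Y' Z Z' f g h, ξ.1.2 X X' Y Y' Z Z' f g h = θ.1.2 X X' Y Y' Z Z' f g h) :
    ξ = θ := by
  apply Subtype.ext
  apply Prod.ext
  · funext X Y Z; exact h₁ X Y Z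
  · funext X X' Y Y' Z Z' f g h; exact h₂ X X' Y Y' Z Z' f g h

lemma PsNat.mul_fst (θ ξ : PsNat C) (X Y Z : C) :
    (θ * ξ).1.1 X Y Z = ξ.1.1 X Y Z ≫ θ.1.1 X Y Z := rfl

lemma PsNat.mul_snd (θ ξ : PsNat C) (X X' Y Y' Z Z' : C) (f : X ⟶ X') (g : Y ⟶ Y')
    (h : Z ⟶ Z') :
    (θ * ξ).1.2 X X' Y Y' Z Z' f g h = pre (ξ.1.1 X Y Z) (θ.1.2 X X' Y Y' Z Z' f g h) +
      post (ξ.1.2 X X' Y Y' Z Z' f g h) (θ.1.1 X' Y' Z') := rfl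

lemma PsNat.one_fst (X Y Z : C) : (1 : PsNat C).1.1 X Y Z = 𝟙 _ := rfl

lemma PsNat.one_snd (X X' Y Y' Z Z' : C) (f : X ⟶ X') (g : Y ⟶ Y') (h : Z ⟶ Z') :
    (1 : PsNat C).1.2 X X' Y Y' Z Z' f g h = 0 := rfl

/-- The algebra of pseudonatural endomorphisms of `⊗²` under vertical composition. -/
instance : Ring (PsNat C) :=
  { (inferInstance : AddCommGroup (PsNat C)), (inferInstance : Mul (PsNat C)),
    (inferInstance : One (PsNat C)) with
    left_distrib := fun a b c => by
      apply PsNat.ext' <;> intros <;> simp [PsNat.mul_fst, PsNat.mul_snd] <;> abel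
    right_distrib := fun a b c => by
      apply PsNat.ext' <;> intros <;> simp [PsNat.mul_fst, PsNat.mul_snd] <;> abel
    zero_mul := fun a => by
      apply PsNat.ext' <;> intros <;> simp [PsNat.mul_fst, PsNat.mul_snd]
    mul_zero := fun a => by
      apply PsNat.ext' <;> intros <;> simp [PsNat.mul_fst, PsNat.mul_snd]
    one_mul := fun a => by
      apply PsNat.ext' <;> intros <;>
        simp [PsNat.mul_fst, PsNat.mul_snd, PsNat.one_fst, PsNat.one_snd, post_id]
    mul_one := fun a => by
      apply PsNat.ext' <;> intros <;>
        simp [PsNat.mul_fst, PsNat.mul_snd, PsNat.one_fst, PsNat.one_snd, pre_id]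
    mul_assoc := fun a b c => by
      apply PsNat.ext' <;> intros <;>
        simp [PsNat.mul_fst, PsNat.mul_snd, pre_pre, post_post, pre_post, add_assoc]
    zsmul := fun n a => n • a
    zsmul_zero' := fun a => zero_zsmul a
    zsmul_succ' := fun n a => SubNegMonoid.zsmul_succ' n a
    zsmul_neg' := fun n a => SubNegMonoid.zsmul_neg' n a
    nsmul := fun n a => n • a
    nsmul_zero := fun a => zero_nsmul a
    nsmul_succ := fun n a => succ_nsmul a n }

instance : Algebra ℂ (PsNat C) := Algebra.ofModule
  (fun c a b => by
    apply PsNat.ext' <;> intros <;> simp [PsNat.mul_fst, PsNat.mul_snd])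
  (fun c a b => by
    apply PsNat.ext' <;> intros <;> simp [PsNat.mul_fst, PsNat.mul_snd])

variable (C) in
/-- The components `Ξ_U` of modifications between pseudonatural endomorphisms of `⊗²`.  Every such
family is a modification `Ξ : ξ ⇛ ξ'` for all `ξ`, `ξ'` with `ξ_U - ξ'_U = d Ξ_U` and
`ξ_f - ξ'_f = ⊗²(f) Ξ_U - Ξ_{U'} ⊗²(f)`; two modifications with the same source and target are
equal if and only if their components are. -/
def ModFam : Type max u w := ∀ X Y Z : C, H (X ⊗ (Y ⊗ Z)) (X ⊗ (Y ⊗ Z))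

instance : AddCommGroup (ModFam C) :=
  inferInstanceAs (AddCommGroup (∀ X Y Z : C, H (X ⊗ (Y ⊗ Z)) (X ⊗ (Y ⊗ Z))))

instance : Module ℂ (ModFam C) :=
  inferInstanceAs (Module ℂ (∀ X Y Z : C, H (X ⊗ (Y ⊗ Z)) (X ⊗ (Y ⊗ Z))))

/-- Post-whiskering `(θ Ξ)_U = θ_U Ξ_U`. -/
instance : Module (PsNat C) (ModFam C) where
  smul θ Ξ := fun X Y Z => post (Ξ X Y Z) (θ.1.1 X Y Z)
  one_smul Ξ := by funext X Y Z; exact post_id _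
  mul_smul θ ξ Ξ := by funext X Y Z; exact (post_post _ _ _).symm
  smul_zero θ := by funext X Y Z; exact LinearMap.map_zero₂ _ _
  zero_smul Ξ := by funext X Y Z; exact map_zero _
  smul_add θ Ξ Ξ' := by funext X Y Z; exact LinearMap.map_add₂ _ _ _ _
  add_smul θ ξ Ξ := by funext X Y Z; exact map_add _ _ _

/-- Pre-whiskering `(Ξ ξ)_U = Ξ_U ξ_U`. -/
instance : Module (PsNat C)ᵐᵒᵖ (ModFam C) where
  smul ξ Ξ := fun X Y Z => pre (ξ.unop.1.1 X Y Z) (Ξ X Y Z)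
  one_smul Ξ := by funext X Y Z; exact pre_id _
  mul_smul θ ξ Ξ := by funext X Y Z; exact (pre_pre _ _ _).symm
  smul_zero θ := by funext X Y Z; exact map_zero _
  zero_smul Ξ := by funext X Y Z; exact LinearMap.map_zero₂ _ _
  smul_add θ Ξ Ξ' := by funext X Y Z; exact map_add _ _ _
  add_smul θ ξ Ξ := by funext X Y Z; exact LinearMap.map_add₂ _ _ _ _

/-! ### The pseudonatural endomorphisms and modifications built from an infinitesimal 2-braiding -/

section Auxiliary

variable {X X' X'' Y Y' Y'' Z Z' : C}

lemma tensor_sub_right (f : X ⟶ X') (g h : Y ⟶ Y') : f ⊗ₘ (g - h) = (f ⊗ₘ g) - (f ⊗ₘ h) := by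
  rw [eq_sub_iff_add_eq, ← MonoidalPreadditive.tensor_add, sub_add_cancel]

lemma tensor_sub_left (f g : X ⟶ X') (h : Y ⟶ Y') : (f - g) ⊗ₘ h = (f ⊗ₘ h) - (g ⊗ₘ h) := by
  rw [eq_sub_iff_add_eq, ← MonoidalPreadditive.add_tensor, sub_add_cancel]

lemma pre_tensL_right (k : H X X') (u : Y ⟶ Y') (g : Y' ⟶ Y'') :
    pre (𝟙 X ⊗ₘ u) (tensL k g) = tensL k (u ≫ g) := by
  rw [← tensL_pre, pre_id]

lemma post_tensL_right (k : H X X') (g : Y ⟶ Y') (u : Y' ⟶ Y'') :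
    post (tensL k g) (𝟙 X' ⊗ₘ u) = tensL k (g ≫ u) := by
  rw [← tensL_post, post_id]

lemma pre_tensR_right (f : X ⟶ X') (u : Y ⟶ Y') (l : H Y' Y'') :
    pre (𝟙 X ⊗ₘ u) (tensR f l) = tensR f (pre u l) := by
  rw [← tensR_pre, Category.id_comp]

lemma post_tensR_right (f : X ⟶ X') (l : H Y Y') (u : Y' ⟶ Y'') :
    post (tensR f l) (𝟙 X' ⊗ₘ u) = tensR f (post l u) := by
  rw [← tensR_post, Category.comp_id]

lemma pre_tensL_left (u : X ⟶ X') (k : H X' X'') (g : Y ⟶ Y') :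
    pre (u ⊗ₘ 𝟙 Y) (tensL k g) = tensL (pre u k) g := by
  rw [← tensL_pre, Category.id_comp]

lemma post_tensL_left (k : H X X') (u : X' ⟶ X'') (g : Y ⟶ Y') :
    post (tensL k g) (u ⊗ₘ 𝟙 Y') = tensL (post k u) g := by
  rw [← tensL_post, Category.comp_id]

lemma pre_tensR_left (u : X ⟶ X') (f : X' ⟶ X'') (l : H Y Y') :
    pre (u ⊗ₘ 𝟙 Y) (tensR f l) = tensR (u ≫ f) l := by
  rw [← tensR_pre, pre_id]

lemma post_tensR_left (f : X ⟶ X') (u : X' ⟶ X'') (l : H Y Y') :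
    post (tensR f l) (u ⊗ₘ 𝟙 Y') = tensR (f ≫ u) l := by
  rw [← tensR_post, post_id]

/-- Conjugating a pseudonatural endomorphism of a trilinear enriched functor by a natural
isomorphism to `⊗²` gives a pseudonatural endomorphism of `⊗²`. -/
lemma isPsNat_conj (G : C → C → C → C)
    (G₀ : ∀ {X X' Y Y' Z Z' : C}, (X ⟶ X') → (Y ⟶ Y') → (Z ⟶ Z') → (G X Y Z ⟶ G X' Y' Z'))
    (G₁ : ∀ {X X' Y Y' Z Z' : C}, H X X' → (Y ⟶ Y') → (Z ⟶ Z') → H (G X Y Z) (G X' Y' Z'))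
    (G₂ : ∀ {X X' Y Y' Z Z' : C}, (X ⟶ X') → H Y Y' → (Z ⟶ Z') → H (G X Y Z) (G X' Y' Z'))
    (G₃ : ∀ {X X' Y Y' Z Z' : C}, (X ⟶ X') → (Y ⟶ Y') → H Z Z' → H (G X Y Z) (G X' Y' Z'))
    (e : ∀ X Y Z : C, X ⊗ (Y ⊗ Z) ≅ G X Y Z)
    (n₀ : ∀ {X X' Y Y' Z Z' : C} (f : X ⟶ X') (g : Y ⟶ Y') (h : Z ⟶ Z'),
      (f ⊗ₘ (g ⊗ₘ h)) ≫ (e X' Y' Z').hom = (e X Y Z).hom ≫ G₀ f g h)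
    (n₁ : ∀ {X X' Y Y' Z Z' : C} (k : H X X') (g : Y ⟶ Y') (h : Z ⟶ Z'),
      post (tensL k (g ⊗ₘ h)) (e X' Y' Z').hom = pre (e X Y Z).hom (G₁ k g h))
    (n₂ : ∀ {X X' Y Y' Z Z' : C} (f : X ⟶ X') (k : H Y Y') (h : Z ⟶ Z'),
      post (tensR f (tensL k h)) (e X' Y' Z').hom = pre (e X Y Z).hom (G₂ f k h))
    (n₃ : ∀ {X X' Y Y' Z Z' : C} (f : X ⟶ X') (g : Y ⟶ Y') (k : H Z Z'),
      post (tensR f (tensR g k)) (e X' Y' Z').hom = pre (e X Y Z).hom (G₃ f g k))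
    (app : ∀ X Y Z : C, G X Y Z ⟶ G X Y Z)
    (htpy : ∀ {X X' Y Y' Z Z' : C}, (X ⟶ X') → (Y ⟶ Y') → (Z ⟶ Z') → H (G X Y Z) (G X' Y' Z'))
    (a₁ : ∀ {X X' Y Y' Z Z' : C} (f f' : X ⟶ X') (g : Y ⟶ Y') (h : Z ⟶ Z'),
      htpy (f + f') g h = htpy f g h + htpy f' g h)
    (a₂ : ∀ {X X' Y Y' Z Z' : C} (f : X ⟶ X') (g g' : Y ⟶ Y') (h : Z ⟶ Z'),
      htpy f (g + g') h = htpy f g h + htpy f g' h)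
    (a₃ : ∀ {X X' Y Y' Z Z' : C} (f : X ⟶ X') (g : Y ⟶ Y') (h h' : Z ⟶ Z'),
      htpy f g (h + h') = htpy f g h + htpy f g h')
    (b₁ : ∀ {X X' Y Y' Z Z' : C} (c : ℂ) (f : X ⟶ X') (g : Y ⟶ Y') (h : Z ⟶ Z'),
      htpy (c • f) g h = c • htpy f g h)
    (b₂ : ∀ {X X' Y Y' Z Z' : C} (c : ℂ) (f : X ⟶ X') (g : Y ⟶ Y') (h : Z ⟶ Z'),
      htpy f (c • g) h = c • htpy f g h)
    (b₃ : ∀ {X X' Y Y' Z Z' : C} (c : ℂ) (f : X ⟶ X') (g : Y ⟶ Y') (h : Z ⟶ Z'),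
      htpy f g (c • h) = c • htpy f g h)
    (c₀ : ∀ {X X' Y Y' Z Z' : C} (f : X ⟶ X') (g : Y ⟶ Y') (h : Z ⟶ Z'),
      app X Y Z ≫ G₀ f g h - G₀ f g h ≫ app X' Y' Z' = d (htpy f g h))
    (c₁ : ∀ {X X' Y Y' Z Z' : C} (k : H X X') (g : Y ⟶ Y') (h : Z ⟶ Z'),
      pre (app X Y Z) (G₁ k g h) - post (G₁ k g h) (app X' Y' Z') = htpy (d k) g h)
    (c₂ : ∀ {X X' Y Y' Z Z' : C} (f : X ⟶ X') (k : H Y Y') (h : Z ⟶ Z'),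
      pre (app X Y Z) (G₂ f k h) - post (G₂ f k h) (app X' Y' Z') = htpy f (d k) h)
    (c₃ : ∀ {X X' Y Y' Z Z' : C} (f : X ⟶ X') (g : Y ⟶ Y') (k : H Z Z'),
      pre (app X Y Z) (G₃ f g k) - post (G₃ f g k) (app X' Y' Z') = htpy f g (d k))
    (c₄ : ∀ {X X' X'' Y Y' Y'' Z Z' Z'' : C} (f : X ⟶ X') (f' : X' ⟶ X'')
      (g : Y ⟶ Y') (g' : Y' ⟶ Y'') (h : Z ⟶ Z') (h' : Z' ⟶ Z''),
      htpy (f ≫ f') (g ≫ g') (h ≫ h')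
        = pre (G₀ f g h) (htpy f' g' h') + post (htpy f g h) (G₀ f' g' h')) :
    IsPsNat (C := C)
      (fun X Y Z => (e X Y Z).hom ≫ app X Y Z ≫ (e X Y Z).inv,
       fun X X' Y Y' Z Z' f g h => post (pre (e X Y Z).hom (htpy f g h)) (e X' Y' Z').inv) := by
  have m₀ : ∀ {X X' Y Y' Z Z' : C} (f : X ⟶ X') (g : Y ⟶ Y') (h : Z ⟶ Z'),
      f ⊗ₘ (g ⊗ₘ h) = (e X Y Z).hom ≫ G₀ f g h ≫ (e X' Y' Z').inv := by
    intros
    rw [← Category.assoc, ← n₀]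
    simp
  have m₁ : ∀ {X X' Y Y' Z Z' : C} (k : H X X') (g : Y ⟶ Y') (h : Z ⟶ Z'),
      tensL k (g ⊗ₘ h) = post (pre (e X Y Z).hom (G₁ k g h)) (e X' Y' Z').inv := by
    intros
    rw [← n₁]
    simp [post_post, post_id]
  have m₂ : ∀ {X X' Y Y' Z Z' : C} (f : X ⟶ X') (k : H Y Y') (h : Z ⟶ Z'),
      tensR f (tensL k h) = post (pre (e X Y Z).hom (G₂ f k h)) (e X' Y' Z').inv := by
    intros
    rw [← n₂]
    simp [post_post, post_id]
  have m₃ : ∀ {X X' Y Y' Z Z' : C} (f : X ⟶ X') (g : Y ⟶ Y') (k : H Z Z'),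
      tensR f (tensR g k) = post (pre (e X Y Z).hom (G₃ f g k)) (e X' Y' Z').inv := by
    intros
    rw [← n₃]
    simp [post_post, post_id]
  constructor <;> intros <;> simp only [PsNatData.app, PsNatData.htpy]
  · rw [a₁]; simp
  · rw [a₂]; simp
  · rw [a₃]; simp
  · rw [b₁]; simp
  · rw [b₂]; simp
  · rw [b₃]; simp
  · rw [d_post, d_pre, ← c₀, m₀]; simp
  · rw [← c₁, m₁]; simp [pre_pre, post_post, pre_post]
  · rw [← c₂, m₂]; simp [pre_pre, post_post, pre_post]
  · rw [← c₃, m₃]; simp [pre_pre, post_post, pre_post]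
  · rw [c₄, m₀, m₀]; simp [pre_pre, post_post, pre_post]

end Auxiliary

namespace Inf2Braiding

variable (t : Inf2Braiding C)

/-- `t₂₃ = ⊗(1 ⊠ t)`. -/
def data23 : PsNatData C :=
  (fun X Y Z => 𝟙 X ⊗ₘ t.app Y Z, fun _ _ _ _ _ _ f g h => tensR f (t.htpy g h))

/-- `t₁₂ = ⊗(t ⊠ 1)`. -/
def data12 : PsNatData C :=
  (fun X Y Z => (α_ X Y Z).inv ≫ (t.app X Y ⊗ₘ 𝟙 Z) ≫ (α_ X Y Z).hom,
   fun X X' Y Y' Z Z' f g h =>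
    post (pre (α_ X Y Z).inv (tensL (t.htpy f g) h)) (α_ X' Y' Z').hom)

/-- The isomorphism `γ_{X,Y} ⊗ 1_Z`, with the associators written out. -/
def swap (X Y Z : C) : X ⊗ (Y ⊗ Z) ≅ Y ⊗ (X ⊗ Z) :=
  (α_ X Y Z).symm ≪≫ (whiskerRightIso (β_ X Y) Z) ≪≫ α_ Y X Z

/-- `t₁₃ = ⊗([γ⁻¹ ⊠ 1] (1 ⊠ t)_{τ ⊠ id} [γ ⊠ 1])`. -/
def data13 : PsNatData C :=
  (fun X Y Z => (swap X Y Z).hom ≫ (𝟙 Y ⊗ₘ t.app X Z) ≫ (swap X Y Z).inv,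
   fun X X' Y Y' Z Z' f g h =>
    post (pre (swap X Y Z).hom (tensR g (t.htpy f h))) (swap X' Y' Z').inv)

/-- `t₁₍₂₃₎ = t_{id ⊠ ⊗}`. -/
def data1_23 : PsNatData C :=
  (fun X Y Z => t.app X (Y ⊗ Z), fun _ _ _ _ _ _ f g h => t.htpy f (g ⊗ₘ h))

/-- `t₍₁₂₎₃ = t_{⊗ ⊠ id}`. -/
def data12_3 : PsNatData C :=
  (fun X Y Z => (α_ X Y Z).inv ≫ t.app (X ⊗ Y) Z ≫ (α_ X Y Z).hom,
   fun X X' Y Y' Z Z' f g h =>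
    post (pre (α_ X Y Z).inv (t.htpy (f ⊗ₘ g) h)) (α_ X' Y' Z').hom)

lemma isPsNat_data23 : IsPsNat t.data23 := by
  constructor <;> intros <;> simp only [PsNatData.app, PsNatData.htpy, data23]
  · simp
  · simp
  · simp
  · simp
  · simp
  · simp
  · rw [d_tensR, ← t.d_htpy, tensor_sub_right, tensorHom_comp_tensorHom, tensorHom_comp_tensorHom,
      Category.id_comp, Category.comp_id]
  · rw [← tens_d, ← t.d_htpy, map_sub, pre_tensL_right, post_tensL_right]
  · rw [← t.htpy_d_left, map_sub, pre_tensR_right, post_tensR_right]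
  · rw [← t.htpy_d_right, map_sub, pre_tensR_right, post_tensR_right]
  · rw [t.htpy_comp, map_add, tensR_pre, tensR_post]

lemma isPsNat_data12 : IsPsNat t.data12 := by
  refine isPsNat_conj (fun X Y Z => (X ⊗ Y) ⊗ Z) (fun f g h => (f ⊗ₘ g) ⊗ₘ h)
    (fun k g h => tensL (tensL k g) h) (fun f k h => tensL (tensR f k) h)
    (fun f g k => tensR (f ⊗ₘ g) k) (fun X Y Z => (α_ X Y Z).symm) ?_ ?_ ?_ ?_
    (fun X Y Z => t.app X Y ⊗ₘ 𝟙 Z) (fun f g h => tensL (t.htpy f g) h)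
    ?_ ?_ ?_ ?_ ?_ ?_ ?_ ?_ ?_ ?_ ?_ <;> intros <;> try simp only [Iso.symm_hom]
  · simp
  · rename_i k g h
    have := assoc_left k g h
    apply_fun (fun x => post (pre (α_ _ _ _).inv x) (α_ _ _ _).inv) at this
    simpa [pre_pre, post_post, pre_post, pre_id, post_id] using this.symm
  · rename_i k g h
    have := assoc_middle k g h
    apply_fun (fun x => post (pre (α_ _ _ _).inv x) (α_ _ _ _).inv) at this
    simpa [pre_pre, post_post, pre_post, pre_id, post_id] using this.symm
  · rename_i k g h
    have := assoc_right k g h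
    apply_fun (fun x => post (pre (α_ _ _ _).inv x) (α_ _ _ _).inv) at this
    simpa [pre_pre, post_post, pre_post, pre_id, post_id] using this.symm
  · simp
  · simp
  · simp
  · simp
  · simp
  · simp
  · rw [d_tensL, ← t.d_htpy, tensor_sub_left, tensorHom_comp_tensorHom, tensorHom_comp_tensorHom,
      Category.id_comp, Category.comp_id]
  · rw [← t.htpy_d_left, map_sub, LinearMap.sub_apply, pre_tensL_left, post_tensL_left]
  · rw [← t.htpy_d_right, map_sub, LinearMap.sub_apply, pre_tensL_left, post_tensL_left]
  · rw [tens_d, ← t.d_htpy, map_sub, LinearMap.sub_apply, pre_tensR_left, post_tensR_left]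
  · rw [t.htpy_comp, map_add, LinearMap.add_apply, tensL_pre, tensL_post]

lemma isPsNat_data13 : IsPsNat t.data13 := by
  obtain ⟨a1, a2, a3, b1, b2, b3, c1, c2, c3, c4, c5⟩ := t.isPsNat_data23
  have i1 : ∀ {X X' Y Y' Z Z' : C} (k : H X X') (g : Y ⟶ Y') (h : Z ⟶ Z'),
      post (tensL k (g ⊗ₘ h)) (α_ X' Y' Z').inv = pre (α_ X Y Z).inv (tensL (tensL k g) h) := by
    intro _ _ _ _ _ _ k g h
    have := assoc_left k g h
    apply_fun (fun x => post (pre (α_ _ _ _).inv x) (α_ _ _ _).inv) at this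
    simpa [pre_pre, post_post, pre_post, pre_id, post_id] using this.symm
  have i2 : ∀ {X X' Y Y' Z Z' : C} (f : X ⟶ X') (k : H Y Y') (h : Z ⟶ Z'),
      post (tensR f (tensL k h)) (α_ X' Y' Z').inv
        = pre (α_ X Y Z).inv (tensL (tensR f k) h) := by
    intro _ _ _ _ _ _ k g h
    have := assoc_middle k g h
    apply_fun (fun x => post (pre (α_ _ _ _).inv x) (α_ _ _ _).inv) at this
    simpa [pre_pre, post_post, pre_post, pre_id, post_id] using this.symm
  have i3 : ∀ {X X' Y Y' Z Z' : C} (f : X ⟶ X') (g : Y ⟶ Y') (k : H Z Z'),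
      post (tensR f (tensR g k)) (α_ X' Y' Z').inv
        = pre (α_ X Y Z).inv (tensR (f ⊗ₘ g) k) := by
    intro _ _ _ _ _ _ k g h
    have := assoc_right k g h
    apply_fun (fun x => post (pre (α_ _ _ _).inv x) (α_ _ _ _).inv) at this
    simpa [pre_pre, post_post, pre_post, pre_id, post_id] using this.symm
  refine isPsNat_conj (fun X Y Z => Y ⊗ (X ⊗ Z)) (fun f g h => g ⊗ₘ (f ⊗ₘ h))
    (fun k g h => tensR g (tensL k h)) (fun f k h => tensL k (f ⊗ₘ h))
    (fun f g k => tensR g (tensR f k)) swap ?_ ?_ ?_ ?_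
    (fun X Y Z => 𝟙 Y ⊗ₘ t.app X Z) (fun f g h => tensR g (t.htpy f h))
    ?_ ?_ ?_ ?_ ?_ ?_ ?_ ?_ ?_ ?_ ?_ <;> intros
  · simp only [swap, Iso.trans_hom, Iso.symm_hom, whiskerRightIso_hom, ← tensorHom_id]
    rw [associator_inv_naturality_assoc, tensorHom_comp_tensorHom_assoc,
      BraidedCategory.braiding_naturality, Category.comp_id, Category.assoc, Category.assoc,
      ← associator_naturality, tensorHom_comp_tensorHom_assoc, Category.id_comp]
  · simp only [swap, Iso.trans_hom, Iso.symm_hom, whiskerRightIso_hom, ← tensorHom_id]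
    rw [← post_post, ← post_post, i1, ← pre_post, post_tensL_left, braid_left, ← pre_tensL_left,
      ← pre_post, ← pre_post, assoc_middle, pre_pre, pre_pre, Category.assoc]
  · simp only [swap, Iso.trans_hom, Iso.symm_hom, whiskerRightIso_hom, ← tensorHom_id]
    rw [← post_post, ← post_post, i2, ← pre_post, post_tensL_left, braid_right, ← pre_tensL_left,
      ← pre_post, ← pre_post, assoc_left, pre_pre, pre_pre, Category.assoc]
  · simp only [swap, Iso.trans_hom, Iso.symm_hom, whiskerRightIso_hom, ← tensorHom_id]
    rw [← post_post, ← post_post, i3, ← pre_post, post_tensR_left, BraidedCategory.braiding_naturality,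
      ← pre_tensR_left, ← pre_post, ← pre_post, assoc_right, pre_pre, pre_pre, Category.assoc]
  · exact a2 _ _ _ _
  · exact a1 _ _ _ _
  · exact a3 _ _ _ _
  · exact b2 _ _ _ _
  · exact b1 _ _ _ _
  · exact b3 _ _ _ _
  · exact c1 _ _ _
  · exact c3 _ _ _
  · exact c2 _ _ _
  · exact c4 _ _ _
  · exact c5 _ _ _ _ _ _

/-- The generators attached to an infinitesimal 2-braiding: the pseudonatural endomorphisms `t₁₂`,
`t₂₃`, `t₁₃` of `⊗²` and the four-term relationators `L = t_{t₁₂}`, `R = t_{t₂₃}`, i.e.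
`L_{XYZ} = t_{t_{XY} ⊠ 1_Z}` and `R_{XYZ} = t_{1_X ⊠ t_{YZ}}`. -/
def generators : KZGenerators (PsNat C) (ModFam C) where
  t12 := ⟨t.data12, t.isPsNat_data12⟩
  t23 := ⟨t.data23, t.isPsNat_data23⟩
  t13 := ⟨t.data13, t.isPsNat_data13⟩
  L := fun X Y Z =>
    post (pre (α_ X Y Z).inv (t.htpy (t.app X Y) (𝟙 Z))) (α_ X Y Z).hom
  R := fun X Y Z => t.htpy (𝟙 X) (t.app Y Z)

/-- `t` is symmetric: `t = γ⁻¹ t_τ γ`. -/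
structure IsSymmetric : Prop where
  app_eq : ∀ X Y : C, t.app X Y = (β_ X Y).hom ≫ t.app Y X ≫ (β_ X Y).inv
  htpy_eq : ∀ {X X' Y Y' : C} (f : X ⟶ X') (g : Y ⟶ Y'),
    t.htpy f g = post (pre (β_ X Y).hom (t.htpy g f)) (β_ X' Y').inv

/-- `t` is strict: `t₁₍₂₃₎ = t₁₂ + t₁₃` and `t₍₁₂₎₃ = t₂₃ + t₁₃`. -/
structure IsStrict : Prop where
  right : t.data1_23 = t.data12 + t.data13
  left : t.data12_3 = t.data23 + t.data13

end Inf2Braiding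
end Categorical

/-! ## Weak integrals and derivatives

Functions with values in a complex vector space are integrated and differentiated through linear
functionals.  For finite-dimensional spaces, and for functions of the form `∑ fᵢ(s) vᵢ` with scalar
`fᵢ`, this is the usual integral and derivative. -/

section Calculus

variable {V : Type*} [AddCommGroup V] [Module ℂ V]

/-- `I` is the integral of `φ` from `a` to `b`. -/
def HasWeakIntegral (φ : ℝ → V) (a b : ℝ) (I : V) : Prop :=
  ∀ ℓ : V →ₗ[ℂ] ℂ, IntervalIntegrable (fun r => ℓ (φ r)) MeasureTheory.volume a b ∧
    ∫ r in a..b, ℓ (φ r) = ℓ I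

/-- `φ` is integrable between `a` and `b`. -/
def WeakIntegrable (φ : ℝ → V) (a b : ℝ) : Prop := ∃ I, HasWeakIntegral φ a b I

open Classical in
/-- The integral of `φ` from `a` to `b`, and `0` if `φ` is not integrable. -/
noncomputable def weakIntegral (φ : ℝ → V) (a b : ℝ) : V :=
  if h : WeakIntegrable φ a b then h.choose else 0

lemma HasWeakIntegral.eq {φ : ℝ → V} {a b : ℝ} {I : V} (h : HasWeakIntegral φ a b I) :
    weakIntegral φ a b = I := by
  have hφ : WeakIntegrable φ a b := ⟨I, h⟩
  rw [weakIntegral, dif_pos hφ, ← sub_eq_zero, ← Module.forall_dual_apply_eq_zero_iff ℂ]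
  intro ℓ
  rw [map_sub, ← (hφ.choose_spec ℓ).2, ← (h ℓ).2, sub_self]

/-- `v` is the derivative of `φ` at `s` within `S`. -/
def HasWeakDerivWithinAt (φ : ℝ → V) (v : V) (S : Set ℝ) (s : ℝ) : Prop :=
  ∀ ℓ : V →ₗ[ℂ] ℂ, HasDerivWithinAt (fun r => ℓ (φ r)) (ℓ v) S s

end Calculus

/-! ## Formal power series, parallel transport and 2-holonomy

A formal power series `∑ ħⁿ xₙ` with coefficients in `V` is the function `n ↦ xₙ`. -/

section Holonomy

variable {A M : Type*} [Ring A] [Algebra ℂ A] [AddCommGroup M] [Module ℂ M] [Module A M]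
  [Module Aᵐᵒᵖ M]

/-- The product `x m` of formal power series, for the left action. -/
def leftMul (x : ℕ → A) (m : ℕ → M) : ℕ → M :=
  fun n => ∑ p ∈ Finset.HasAntidiagonal.antidiagonal n, x p.1 • m p.2

/-- The product `m x` of formal power series, for the right action. -/
def rightMul (m : ℕ → M) (x : ℕ → A) : ℕ → M :=
  fun n => ∑ p ∈ Finset.HasAntidiagonal.antidiagonal n, MulOpposite.op (x p.2) • m p.1

/-- The iterated integral series solving the formal linear ODE `dω/dr = ħ Y ω`, `ω(r₀) = 1`:
`formalTransport Y r₀ r n` is the coefficient of `ħⁿ` in the transport from `r₀` to `r`. -/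
noncomputable def formalTransport (Y : ℝ → A) (r₀ : ℝ) : ℝ → ℕ → A
  | _, 0 => 1
  | r, n + 1 => weakIntegral (fun u => Y u * formalTransport Y r₀ u n) r₀ r

namespace KZGenerators

variable (D : KZGenerators A M)

/-- `Λ = t₁₂ + t₂₃ + t₁₃`. -/
def Λ : A := D.t12 + D.t23 + D.t13

/-- `t₁₃ - Λ`. -/
def t13bar : A := D.t13 - D.Λ

/-- The 1-form `Γ = (t₁₂ / z + t₂₃ / (z - 1)) dz`, at the point `z` on the tangent vector `X`. -/
noncomputable def Γ (z X : ℂ) : A := (X / z) • D.t12 + (X / (z - 1)) • D.t23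

/-- The 1-form `∇ = (t₁₂ / z + t₂₃ / (z - 1)) dz + (Λ / v) dv`, at the point `q = (z, v)` on the
tangent vector `X`. -/
noncomputable def nabla (q X : ℂ × ℂ) : A := D.Γ q.1 X.1 + (X.2 / q.2) • D.Λ

/-- `(dz ∧ dv)[X, Y]`, in the normalisation `α ∧ β = (α ⊗ β - β ⊗ α) / 2` (the one for which the
curvature `∇ ∧ ∇` built from the commutator takes the value `[∇ X, ∇ Y]` on `X`, `Y`). -/
noncomputable def dzdv (X Y : ℂ × ℂ) : ℂ := (X.1 * Y.2 - X.2 * Y.1) / 2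

/-- The 2-form `Δ = 2 (L / (z v) + R / ((z - 1) v)) dz ∧ dv`, at the point `q = (z, v)` on the
tangent vectors `X`, `Y`. -/
noncomputable def Delta (q X Y : ℂ × ℂ) : M :=
  (2 * dzdv X Y) • ((1 / (q.1 * q.2)) • D.L + (1 / ((q.1 - 1) * q.2)) • D.R)

/-- The parallel transport of `ħ Γ` along the path `c` in `ℂ ∖ {0, 1}` from time `r₀` to `r`. -/
noncomputable def transportΓ (c : ℝ → ℂ) (r₀ r : ℝ) : ℕ → A :=
  formalTransport (fun u => D.Γ (c u) (deriv c u)) r₀ r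

/-- The parallel transport of `ħ ∇` along the path `p` from time `r₀` to `r`. -/
noncomputable def transport (p : ℝ → ℂ × ℂ) (r₀ r : ℝ) : ℕ → A :=
  formalTransport (fun u => D.nabla (p u) (deriv p u)) r₀ r

/-- The integrand `W_{1r} ħ² Δ[∂P/∂s, ∂P/∂r] W_{r0}` of the 2-holonomy along the 2-path
`(s, r) ↦ P s r`, where `W` is the parallel transport along the cross-sectional path `P s`. -/
noncomputable def holIntegrand (P : ℝ → ℝ → ℂ × ℂ) (s r : ℝ) : ℕ → M :=
  rightMul
    (leftMul (D.transport (P s) r 1)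
      (Pi.single 2 (D.Delta (P s r) (deriv (fun s' => P s' r) s) (deriv (P s) r))))
    (D.transport (P s) 0 r)

/-- The components of the 2-holonomy
`W^P = ∫₀¹ ∫₀¹ W_{1r} ħ² Δ[∂P/∂s, ∂P/∂r] W_{r0} dr ds + ID` of `(ħ ∇, ħ² Δ)` along `P`
(the identity modification `ID` of the transport along `P 1` has zero components). -/
noncomputable def twoHolonomy (P : ℝ → ℝ → ℂ × ℂ) : ℕ → M :=
  fun n => weakIntegral (fun s => weakIntegral (fun r => D.holIntegrand P s r n) 0 1) 0 1

/-- All the integrals in the definition of the 2-holonomy along `P` exist. -/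
def HolIntegrable (P : ℝ → ℝ → ℂ × ℂ) : Prop :=
  ∀ n, (∀ s ∈ Set.Icc (0 : ℝ) 1, WeakIntegrable (fun r => D.holIntegrand P s r n) 0 1) ∧
    WeakIntegrable (fun s => weakIntegral (fun r => D.holIntegrand P s r n) 0 1) 0 1

end KZGenerators

/-! ## The first vertically-interpolative 2-path -/

/-- `c_I(s) = ε + s (1 - 2 ε)`. -/
def cI (ε s : ℝ) : ℝ := ε + s * (1 - 2 * ε)

/-- The path `c_V ∘ ι`, where `c_V(s) = 1 - 1 / c_I(s)` and `ι(s) = 1 - s`; equivalently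
`1 - 1 / (1 - c_I(s))`, since `c_I(1 - s) = 1 - c_I(s)`. -/
noncomputable def cVι (ε s : ℝ) : ℂ := 1 - 1 / (cI ε (1 - s) : ℂ)

/-- The source 1-path `p_V`. -/
noncomputable def pV (ε : ℝ) (a : ℂ) (r : ℝ) : ℂ × ℂ :=
  (cVι ε r, (1 - cI ε r : ℂ) / (1 - ε : ℂ) * a)

/-- The horizontal 1-path `p_←`. -/
noncomputable def pLeft (ε : ℝ) (a : ℂ) (r : ℝ) : ℂ × ℂ := (cVι ε (2 * r), a)

/-- The 2-path `P_V`. -/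
noncomputable def PV (ε : ℝ) (a : ℂ) (s r : ℝ) : ℂ × ℂ :=
  if r ≤ s / 2 then pLeft ε a r
  else if r ≤ s then (cVι ε s, (1 - cI ε (2 * r - s) : ℂ) / (1 - ε : ℂ) * a)
  else pV ε a r

/-! ## The iterated integral series -/

/-- The coefficient functions of `Ω₀ = ds / s` and `Ω₁ = ds / (s - 1)`. -/
noncomputable def Ω (i : Fin 2) (s : ℝ) : ℂ := 1 / ((s : ℂ) - (i : ℕ))

/-- The iterated integral `∫ₐᵇ ω₁ ⋯ ωₙ = ∫ₐᵇ f₁(s) (∫ₐˢ ω₂ ⋯ ωₙ) ds` of the 1-forms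
`ωᵢ = fᵢ(s) ds`. -/
noncomputable def iterIntegral (a : ℝ) : List (ℝ → ℂ) → ℝ → ℂ
  | [], _ => 1
  | f :: ω, b => ∫ s in a..b, f s * iterIntegral a ω s

namespace KZGenerators

variable (D : KZGenerators A M)

/-- `ad_x m = x m - m x`. -/
def ad (x : A) (m : M) : M := x • m - MulOpposite.op x • m

/-- The operators `ad_{t₁₂}` (for `i = 0`) and `ad_{t₁₃ - Λ} + Λ` (for `i = 1`) on `M`. -/
def op (i : Fin 2) (m : M) : M :=
  if i = 0 then ad D.t12 m else ad D.t13bar m + D.Λ • m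

/-- `Λ^i m Λ^j`. -/
def sandwich (i j : ℕ) (m : M) : M := D.Λ ^ i • (MulOpposite.op (D.Λ ^ j) • m)

/-- The summand of `f_V` of index `(r, k, (i₁, …, i_r), j)`, the list `i` being `[i₁, …, i_r]`:
`∫_ε^x Ω_{i₁} ⋯ Ω_{i_r} op_{i₁} ⋯ op_{i_r} Λ^j [Ω₀ Ω₁^k L - Ω₁^{k+1} (L + R)] Λ^{k-1-j}`. -/
noncomputable def fVTerm (ε x : ℝ) (k j : ℕ) (i : List (Fin 2)) : M :=
  i.foldr D.op (D.sandwich j (k - 1 - j)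
    (iterIntegral ε (i.map Ω ++ Ω 0 :: List.replicate k (Ω 1)) x • D.L -
      iterIntegral ε (i.map Ω ++ List.replicate (k + 1) (Ω 1)) x • (D.L + D.R)))

/-- The series `f_V(s)`: the summand of index `(r, k, i, j)`, `r ≥ 0`, `k ≥ 1`, is of degree
`r + (k - 1) + 2 = r + k + 1` in `ħ`. -/
noncomputable def fV (ε s : ℝ) : ℕ → M := fun n =>
  ∑ q ∈ (Finset.range (n + 1) ×ˢ Finset.range (n + 1)).filter
      (fun q => 1 ≤ q.2 ∧ q.1 + q.2 + 1 = n),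
    ∑ i : Fin q.1 → Fin 2, ∑ j ∈ Finset.range q.2,
      D.fVTerm ε (cI ε s) q.2 j (List.ofFn i)

/-- The series `∑_{k ≥ 1} (ln((1 - c_I(s)) / (1 - ε))^k / k!) ∑_{j < k}
Λ^j (L / z + R / (z - 1)) Λ^{k-1-j}` at `z = c_V(1 - s)`; the summand of index `k` is of degree
`k + 1` in `ħ`. -/
noncomputable def odeSource (ε s : ℝ) : ℕ → M := fun n =>
  ∑ k ∈ (Finset.range (n + 1)).filter (fun k => 1 ≤ k ∧ k + 1 = n),
    ((Real.log ((1 - cI ε s) / (1 - ε)) : ℂ) ^ k / (k.factorial : ℂ)) •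
      ∑ j ∈ Finset.range k, D.sandwich j (k - 1 - j)
        ((1 / cVι ε s) • D.L + (1 / (cVι ε s - 1)) • D.R)

/-- `f` solves the first-order formal ODE
`d/ds [(W^{p_V}_{s0})⁻¹ f W^{p_←}_{s/2,0}] = ∂z/∂s (W^{p_V}_{s0})⁻¹ odeSource(s) W^{p_←}_{s/2,0}`
on `[0, 1]`, coefficient by coefficient; the inverse of the transport along `p_V` from `0` to `s` is
the transport from `s` to `0`. -/
def SolvesODE (ε : ℝ) (a : ℂ) (f : ℝ → ℕ → M) : Prop :=
  ∀ n, ∀ s ∈ Set.Icc (0 : ℝ) 1, HasWeakDerivWithinAt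
    (fun s => rightMul (leftMul (D.transport (pV ε a) s 0) (f s))
      (D.transport (pLeft ε a) 0 (s / 2)) n)
    (deriv (cVι ε) s • rightMul (leftMul (D.transport (pV ε a) s 0) (D.odeSource ε s))
      (D.transport (pLeft ε a) 0 (s / 2)) n)
    (Set.Icc 0 1) s

end KZGenerators

end Holonomy

/-! Along the 2-path put `c = c_I(s)`, so `z = -c / (1 - c)`. Then `dz/z` pulls back to `Ω₀ - Ω₁`
and `dz/(z-1)` to `-Ω₁`, while `dv/v` is `Ω₁` along `p_V`. Hence `Γ` becomes `Ω₀ t₁₂ + Ω₁ (t₁₃ - Λ)`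
(`formLeft`), `∇` along `p_V` becomes the same form plus `Ω₁ Λ` (`formV`), and `(L/z + R/(z-1)) dz`
becomes `Ω₀ L - Ω₁ (L + R)` (`formLR_eq`).

Fix `s`. Away from its vertical segment the 2-path does not depend on `s`, so `Δ` contributes only
there. On that segment the connection is a scalar multiple of `Λ`, the transports are exponentials,
and the integral over `r` reduces to beta integrals in `u = ln((1 - c) / (1 - ε))`. These produce
the source `g(s)` of the ODE (`hasWeakIntegral_vert`). The other two segments multiply it by
transports, and factoring `W_{1s} = W_{10} (W_{s0})⁻¹` along `p_V` turns the inner integral into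
`W_{10} · (W_{s0})⁻¹ g(s) W^←` (`hasWeakIntegral_holIntegrand`).

If `f(0) = 0` and `f' = formV f - f formLeft + g`, then `(W_{s0})⁻¹ f W^←` has derivative
`(W_{s0})⁻¹ g W^←`. The outer integral then follows from the fundamental theorem of calculus, and
`W_{10}` cancels its inverse, leaving `f(1) W^←`. Since `formV f - f formLeft = Ω₀ T₀ f + Ω₁ T₁ f`,
Picard iteration expresses `f` by iterated integrals over words. As `u^k / k!` is itself the
iterated integral of `Ω₁^k`, the outcome is `f_V` (`tameDeriv_fV`).

The coefficient spaces carry no topology. Every integrand met is, at least piecewise, a finite sum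
of continuous scalar functions times fixed vectors, and `TameOn` and `TameDeriv` reduce the analysis
to scalars. -/

/-! ### Calculus for finite sums of scalar functions times vectors -/

section WeakCalculus

open Set MeasureTheory

variable {V W X : Type*} [AddCommGroup V] [Module ℂ V] [AddCommGroup W] [Module ℂ W]
  [AddCommGroup X] [Module ℂ X]

namespace HasWeakIntegral

variable {φ ψ : ℝ → V} {a b c : ℝ} {I J : V}

/-- Agreement on the open interval is enough. This matters at the corners of the paths, where
`deriv` need not be the one-sided velocity. -/
lemma congr (h : HasWeakIntegral φ a b I) (e : EqOn φ ψ (uIoo a b)) :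
    HasWeakIntegral ψ a b I := by
  intro ℓ
  have e' : EqOn (fun r => ℓ (φ r)) (fun r => ℓ (ψ r)) (uIoo a b) := fun r hr => by
    simp only [e hr]
  exact ⟨(h ℓ).1.congr_uIoo e', by rw [← intervalIntegral.integral_congr_uIoo e', (h ℓ).2]⟩

lemma map (T : V →ₗ[ℂ] W) (h : HasWeakIntegral φ a b I) :
    HasWeakIntegral (fun r => T (φ r)) a b (T I) :=
  fun ℓ => h (ℓ ∘ₗ T)

lemma add (h : HasWeakIntegral φ a b I) (h' : HasWeakIntegral ψ a b J) :
    HasWeakIntegral (fun r => φ r + ψ r) a b (I + J) := by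
  intro ℓ
  simp only [map_add]
  exact ⟨(h ℓ).1.add (h' ℓ).1, by
    rw [intervalIntegral.integral_add (h ℓ).1 (h' ℓ).1, (h ℓ).2, (h' ℓ).2]⟩

lemma zero : HasWeakIntegral (fun _ => (0 : V)) a b 0 := by
  intro ℓ
  simp

lemma sum {ι : Type*} (s : Finset ι) {φ : ι → ℝ → V} {I : ι → V}
    (h : ∀ i ∈ s, HasWeakIntegral (φ i) a b (I i)) :
    HasWeakIntegral (fun r => ∑ i ∈ s, φ i r) a b (∑ i ∈ s, I i) := by
  classical
  induction s using Finset.induction_on with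
  | empty => simpa using zero
  | insert i s hi ih =>
    simp only [Finset.sum_insert hi]
    exact (h i (by simp)).add (ih fun j hj => h j (by simp [hj]))

lemma trans (h : HasWeakIntegral φ a b I) (h' : HasWeakIntegral φ b c J) :
    HasWeakIntegral φ a c (I + J) := by
  intro ℓ
  refine ⟨(h ℓ).1.trans (h' ℓ).1, ?_⟩
  rw [← intervalIntegral.integral_add_adjacent_intervals (h ℓ).1 (h' ℓ).1, (h ℓ).2, (h' ℓ).2,
    map_add]

lemma refl : HasWeakIntegral φ a a 0 := by
  intro ℓ
  simp

lemma smul_const {f : ℝ → ℂ} (hf : IntervalIntegrable f volume a b) (v : V) :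
    HasWeakIntegral (fun r => f r • v) a b ((∫ r in a..b, f r) • v) := by
  intro ℓ
  simp only [map_smul, smul_eq_mul]
  exact ⟨hf.mul_const _, intervalIntegral.integral_mul_const _ _⟩

end HasWeakIntegral

lemma WeakIntegrable.hasWeakIntegral {φ : ℝ → V} {a b : ℝ} (h : WeakIntegrable φ a b) :
    HasWeakIntegral φ a b (weakIntegral φ a b) := by
  obtain ⟨I, hI⟩ := h
  rwa [hI.eq]

/-- No integrability is needed: the two integral predicates coincide, so the chosen values, or the
default `0`, coincide as well. -/
lemma weakIntegral_congr {φ ψ : ℝ → V} {a b : ℝ} (e : EqOn φ ψ (uIoo a b)) :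
    weakIntegral φ a b = weakIntegral ψ a b := by
  have h : HasWeakIntegral φ a b = HasWeakIntegral ψ a b := by
    ext I
    exact ⟨fun h => h.congr e, fun h => h.congr e.symm⟩
  unfold weakIntegral WeakIntegrable
  rw [h]

/-- `φ` is on `S` a finite sum `∑ fᵢ vᵢ` with scalar functions `fᵢ` continuous on `S`. -/
inductive TameOn (S : Set ℝ) : (ℝ → V) → Prop
  | smul (f : ℝ → ℂ) (v : V) (hf : ContinuousOn f S) : TameOn S (fun s => f s • v)
  | add {φ ψ : ℝ → V} (hφ : TameOn S φ) (hψ : TameOn S ψ) : TameOn S (fun s => φ s + ψ s)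
  | congr {φ ψ : ℝ → V} (hφ : TameOn S φ) (e : EqOn φ ψ S) : TameOn S ψ

namespace TameOn

variable {S : Set ℝ} {φ ψ : ℝ → V} {a b x y : ℝ}

lemma const (v : V) : TameOn S (fun _ => v) :=
  (smul (fun _ => 1) v continuousOn_const).congr fun s _ => by simp

lemma map (T : V →ₗ[ℂ] W) (h : TameOn S φ) : TameOn S (fun s => T (φ s)) := by
  induction h with
  | smul f v hf => simpa using smul f (T v) hf
  | add _ _ h h' => simpa using h.add h'
  | congr _ e h => exact h.congr fun s hs => by simp [e hs]

lemma const_smul (c : ℂ) (h : TameOn S φ) : TameOn S (fun s => c • φ s) :=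
  h.map (c • LinearMap.id)

lemma fun_smul {f : ℝ → ℂ} (hf : ContinuousOn f S) (h : TameOn S φ) :
    TameOn S (fun s => f s • φ s) := by
  induction h with
  | smul g v hg => simpa [smul_smul] using smul (fun s => f s * g s) v (hf.mul hg)
  | add _ _ h h' => simpa using h.add h'
  | congr _ e h => exact h.congr fun s hs => by simp [e hs]

lemma bilin (B : V →ₗ[ℂ] W →ₗ[ℂ] X) {ψ : ℝ → W} (h : TameOn S φ) (h' : TameOn S ψ) :
    TameOn S (fun s => B (φ s) (ψ s)) := by
  induction h with
  | smul f v hf => simpa using (h'.map (B v)).fun_smul hf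
  | add _ _ h h' => simpa using h.add h'
  | congr _ e h => exact h.congr fun s hs => by simp [e hs]

lemma sum {ι : Type*} (s : Finset ι) {φ : ι → ℝ → V} (h : ∀ i ∈ s, TameOn S (φ i)) :
    TameOn S (fun r => ∑ i ∈ s, φ i r) := by
  classical
  induction s using Finset.induction_on with
  | empty => simpa using const (0 : V)
  | insert i s hi ih =>
    simp only [Finset.sum_insert hi]
    exact (h i (by simp)).add (ih fun j hj => h j (by simp [hj]))

lemma weakIntegrable (h : TameOn (Icc a b) φ) (hx : x ∈ Icc a b) (hy : y ∈ Icc a b) :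
    WeakIntegrable φ x y := by
  have hS : uIcc x y ⊆ Icc a b := ordConnected_Icc.uIcc_subset hx hy
  induction h with
  | smul f v hf => exact ⟨_, .smul_const (hf.mono hS).intervalIntegrable v⟩
  | add _ _ h h' =>
    obtain ⟨I, hI⟩ := h
    obtain ⟨J, hJ⟩ := h'
    exact ⟨_, hI.add hJ⟩
  | congr _ e h =>
    obtain ⟨I, hI⟩ := h
    exact ⟨I, hI.congr (e.mono ((Ioo_subset_Icc_self).trans hS))⟩

end TameOn

/-- `φ` is on `S` a finite sum `∑ fᵢ vᵢ` with scalar functions `fᵢ` differentiable within `S`, and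
`φ'` is the sum `∑ fᵢ' vᵢ`. -/
inductive TameDeriv (S : Set ℝ) : (ℝ → V) → (ℝ → V) → Prop
  | smul (f f' : ℝ → ℂ) (v : V) (hf : ∀ s ∈ S, HasDerivWithinAt f (f' s) S s) :
    TameDeriv S (fun s => f s • v) (fun s => f' s • v)
  | add {φ φ' ψ ψ' : ℝ → V} (hφ : TameDeriv S φ φ') (hψ : TameDeriv S ψ ψ') :
    TameDeriv S (fun s => φ s + ψ s) (fun s => φ' s + ψ' s)
  | congr {φ φ' ψ ψ' : ℝ → V} (hφ : TameDeriv S φ φ') (e : EqOn φ ψ S) (e' : EqOn φ' ψ' S) :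
    TameDeriv S ψ ψ'

namespace TameDeriv

variable {S : Set ℝ} {φ φ' ψ ψ' : ℝ → V} {a b x y : ℝ}

lemma const (v : V) : TameDeriv S (fun _ => v) (fun _ => 0) :=
  (smul (fun _ => 1) (fun _ => 0) v fun _ _ => hasDerivWithinAt_const _ _ _).congr
    (fun s _ => by simp) (fun s _ => by simp)

lemma map (T : V →ₗ[ℂ] W) (h : TameDeriv S φ φ') :
    TameDeriv S (fun s => T (φ s)) (fun s => T (φ' s)) := by
  induction h with
  | smul f f' v hf => simpa using smul f f' (T v) hf
  | add _ _ h h' => simpa using h.add h'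
  | congr _ e e' h => exact h.congr (fun s hs => by simp [e hs]) (fun s hs => by simp [e' hs])

lemma neg (h : TameDeriv S φ φ') : TameDeriv S (fun s => -φ s) (fun s => -φ' s) :=
  h.map (-LinearMap.id)

lemma sub (h : TameDeriv S φ φ') (h' : TameDeriv S ψ ψ') :
    TameDeriv S (fun s => φ s - ψ s) (fun s => φ' s - ψ' s) := by
  simpa only [sub_eq_add_neg] using h.add h'.neg

lemma sum {ι : Type*} (s : Finset ι) {φ φ' : ι → ℝ → V} (h : ∀ i ∈ s, TameDeriv S (φ i) (φ' i)) :
    TameDeriv S (fun r => ∑ i ∈ s, φ i r) (fun r => ∑ i ∈ s, φ' i r) := by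
  classical
  induction s using Finset.induction_on with
  | empty => simpa using const (0 : V)
  | insert i s hi ih =>
    simp only [Finset.sum_insert hi]
    exact (h i (by simp)).add (ih fun j hj => h j (by simp [hj]))

lemma tameOn (h : TameDeriv S φ φ') : TameOn S φ := by
  induction h with
  | smul f f' v hf => exact .smul f v fun s hs => (hf s hs).continuousWithinAt
  | add _ _ h h' => exact h.add h'
  | congr _ e _ h => exact h.congr e

lemma fun_smul {f f' : ℝ → ℂ} (hf : ∀ s ∈ S, HasDerivWithinAt f (f' s) S s)
    (h : TameDeriv S φ φ') :
    TameDeriv S (fun s => f s • φ s) (fun s => f' s • φ s + f s • φ' s) := by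
  induction h with
  | smul g g' v hg =>
    simpa only [smul_smul, ← add_smul] using smul (fun s => f s * g s)
      (fun s => f' s * g s + f s * g' s) v fun s hs => (hf s hs).mul (hg s hs)
  | add _ _ h h' =>
    refine (h.add h').congr (fun s _ => by simp) (fun s _ => ?_)
    simp only [smul_add]
    abel
  | congr _ e e' h =>
    exact h.congr (fun s hs => by simp [e hs]) (fun s hs => by simp [e hs, e' hs])

lemma bilin (B : V →ₗ[ℂ] W →ₗ[ℂ] X) {ψ ψ' : ℝ → W} (h : TameDeriv S φ φ')
    (h' : TameDeriv S ψ ψ') :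
    TameDeriv S (fun s => B (φ s) (ψ s)) (fun s => B (φ' s) (ψ s) + B (φ s) (ψ' s)) := by
  induction h with
  | smul f f' v hf => simpa using (h'.map (B v)).fun_smul hf
  | add _ _ h h' =>
    refine (h.add h').congr (fun s _ => by simp) (fun s _ => ?_)
    simp only [map_add, LinearMap.add_apply]
    abel
  | congr _ e e' h =>
    exact h.congr (fun s hs => by simp [e hs]) (fun s hs => by simp [e hs, e' hs])

lemma hasWeakDerivWithinAt (h : TameDeriv S φ φ') {s : ℝ} (hs : s ∈ S) :
    HasWeakDerivWithinAt φ (φ' s) S s := by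
  intro ℓ
  induction h with
  | smul f f' v hf => simpa using (hf s hs).mul_const (ℓ v)
  | add _ _ h h' =>
    simp only [map_add]
    exact h.add h'
  | congr _ e e' h =>
    rw [← e' hs]
    exact h.congr (fun r hr => by rw [e hr]) (by rw [e hs])

lemma hasWeakIntegral (h : TameDeriv (Icc a b) φ φ') (h' : TameOn (Icc a b) φ')
    (hx : x ∈ Icc a b) (hy : y ∈ Icc a b) : HasWeakIntegral φ' x y (φ y - φ x) := by
  intro ℓ
  have hS : uIcc x y ⊆ Icc a b := ordConnected_Icc.uIcc_subset hx hy
  have hint := ((h'.weakIntegrable hx hy).hasWeakIntegral ℓ).1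
  refine ⟨hint, ?_⟩
  rw [map_sub]
  have hd := fun s (hs : s ∈ Icc a b) => h.hasWeakDerivWithinAt hs ℓ
  -- At the endpoints of `Icc a b` only derivatives within the interval are known. This form of the
  -- theorem asks there for continuity alone.
  refine intervalIntegral.integral_eq_sub_of_hasDeriv_right
    (fun s hs => ((hd s (hS hs)).continuousWithinAt).mono hS) (fun s hs => ?_) hint
  have h1 : a < s := lt_of_le_of_lt (le_min hx.1 hy.1) hs.1
  have h2 : s < b := lt_of_lt_of_le hs.2 (max_le hx.2 hy.2)
  exact ((hd s ⟨h1.le, h2.le⟩).hasDerivAt (Icc_mem_nhds h1 h2)).hasDerivWithinAt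

lemma eq_of_zero (h : TameDeriv (Icc a b) φ (fun _ => 0)) (hx : x ∈ Icc a b) (hy : y ∈ Icc a b) :
    φ y = φ x := by
  have h1 := (h.hasWeakIntegral (.const 0) hx hy).eq
  rw [HasWeakIntegral.zero.eq] at h1
  exact sub_eq_zero.1 h1.symm

end TameDeriv

lemma hasDerivWithinAt_primitive {f : ℝ → ℂ} {a b x s : ℝ} (hf : ContinuousOn f (Icc a b))
    (hx : x ∈ Icc a b) (hs : s ∈ Icc a b) :
    HasDerivWithinAt (fun s => ∫ r in x..s, f r) (f s) (Icc a b) s := by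
  have : Fact (s ∈ Icc a b) := ⟨hs⟩
  exact intervalIntegral.integral_hasDerivWithinAt_right
    (hf.mono (ordConnected_Icc.uIcc_subset hx hs)).intervalIntegrable
    (hf.stronglyMeasurableAtFilter_nhdsWithin measurableSet_Icc s) (hf s hs)

/-- The primitive of `∑ fᵢ vᵢ` is `∑ (∫ fᵢ) vᵢ`. Primitives of tame functions are therefore tame, so
the recursion defining the transport never leaves this class. -/
lemma TameOn.primitive {φ : ℝ → V} {a b x : ℝ} (h : TameOn (Icc a b) φ) (hx : x ∈ Icc a b) :
    TameDeriv (Icc a b) (fun s => weakIntegral φ x s) φ := by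
  induction h with
  | smul f v hf =>
    refine (TameDeriv.smul _ f v fun s hs => hasDerivWithinAt_primitive hf hx hs).congr
      (fun s hs => ?_) (fun _ _ => rfl)
    have hS : uIcc x s ⊆ Icc a b := ordConnected_Icc.uIcc_subset hx hs
    exact (HasWeakIntegral.smul_const (hf.mono hS).intervalIntegrable v).eq.symm
  | add h1 h2 h h' =>
    refine (h.add h').congr (fun s hs => ?_) (fun _ _ => rfl)
    exact ((h1.weakIntegrable hx hs).hasWeakIntegral.add
      (h2.weakIntegrable hx hs).hasWeakIntegral).eq.symm
  | congr h1 e h =>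
    refine h.congr (fun s hs => ?_) e
    exact weakIntegral_congr
      (e.mono (Ioo_subset_Icc_self.trans (ordConnected_Icc.uIcc_subset hx hs)))

/-! ### Cauchy products of formal power series -/

/-- The product of the formal power series `x` and `y` for the bilinear map `B`. -/
def conv (B : V →ₗ[ℂ] W →ₗ[ℂ] X) (x : ℕ → V) (y : ℕ → W) : ℕ → X :=
  fun n => ∑ p ∈ Finset.HasAntidiagonal.antidiagonal n, B (x p.1) (y p.2)

section Conv

variable (B : V →ₗ[ℂ] W →ₗ[ℂ] X)

/-- Four bilinear maps are allowed, so that one reindexing yields associativity in the algebra, both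
module laws and the compatibility of the two actions. -/
lemma conv_assoc {U Y Z : Type*} [AddCommGroup U] [Module ℂ U] [AddCommGroup Y] [Module ℂ Y]
    [AddCommGroup Z] [Module ℂ Z] (C : X →ₗ[ℂ] U →ₗ[ℂ] Z) (D : V →ₗ[ℂ] Y →ₗ[ℂ] Z)
    (E : W →ₗ[ℂ] U →ₗ[ℂ] Y) (h : ∀ v w u, C (B v w) u = D v (E w u)) (x : ℕ → V) (y : ℕ → W)
    (z : ℕ → U) : conv C (conv B x y) z = conv D x (conv E y z) := by
  funext n
  simp only [conv, map_sum, LinearMap.sum_apply, h]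
  rw [Finset.sum_sigma', Finset.sum_sigma']
  exact Finset.sum_nbij' (fun ⟨⟨_i, j⟩, ⟨k, l⟩⟩ ↦ ⟨(k, l + j), (l, j)⟩)
    (fun ⟨⟨i, _j⟩, ⟨k, l⟩⟩ ↦ ⟨(i + k, l), (i, k)⟩) (by
      rintro ⟨⟨i, j⟩, ⟨k, l⟩⟩ h
      simp at h ⊢
      omega) (by
      rintro ⟨⟨i, j⟩, ⟨k, l⟩⟩ h
      simp at h ⊢
      omega) (by aesop) (by aesop) (by aesop)

lemma conv_single_zero_left (v : V) (y : ℕ → W) (n : ℕ) :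
    conv B (Pi.single 0 v) y n = B v (y n) := by
  rw [conv, Finset.sum_eq_single (0, n)]
  · simp
  · rintro ⟨i, j⟩ hij hne
    have hi : i ≠ 0 := by
      rintro rfl
      simp_all
    simp [hi]
  · simp

lemma conv_zero_left_succ (x : ℕ → V) (hx : x 0 = 0) (y : ℕ → W) (n : ℕ) :
    conv B x y (n + 1) = conv B (fun i => x (i + 1)) y n := by
  rw [conv, Finset.Nat.antidiagonal_succ]
  simp [hx, conv]

lemma conv_zero_right_succ (x : ℕ → V) (y : ℕ → W) (hy : y 0 = 0) (n : ℕ) :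
    conv B x y (n + 1) = conv B x (fun i => y (i + 1)) n := by
  rw [conv, Finset.Nat.antidiagonal_succ']
  simp [hy, conv]

lemma conv_apply_zero (x : ℕ → V) (y : ℕ → W) : conv B x y 0 = B (x 0) (y 0) := by
  simp [conv]

lemma conv_single_one_left_succ (v : V) (y : ℕ → W) (n : ℕ) :
    conv B (Pi.single 1 v) y (n + 1) = B v (y n) := by
  rw [conv_zero_left_succ _ _ (by simp), ← conv_single_zero_left]
  congr 1
  funext i
  cases i <;> simp

lemma conv_flip (x : ℕ → V) (y : ℕ → W) : conv B.flip y x = conv B x y := by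
  funext n
  rw [conv, conv, ← Finset.Nat.sum_antidiagonal_swap]
  rfl

lemma conv_single_zero_right (x : ℕ → V) (w : W) (n : ℕ) :
    conv B x (Pi.single 0 w) n = B (x n) w := by
  rw [← conv_flip, conv_single_zero_left]
  rfl

lemma conv_single_one_right_succ (x : ℕ → V) (w : W) (n : ℕ) :
    conv B x (Pi.single 1 w) (n + 1) = B (x n) w := by
  rw [← conv_flip, conv_single_one_left_succ]
  rfl

lemma conv_add_left (x x' : ℕ → V) (y : ℕ → W) : conv B (x + x') y = conv B x y + conv B x' y := by
  funext n
  simp [conv, Finset.sum_add_distrib]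

lemma conv_add_right (x : ℕ → V) (y y' : ℕ → W) :
    conv B x (y + y') = conv B x y + conv B x y' := by
  funext n
  simp [conv, Finset.sum_add_distrib]

lemma conv_neg_left (x : ℕ → V) (y : ℕ → W) : conv B (-x) y = -conv B x y := by
  funext n
  simp [conv]

lemma conv_neg_right (x : ℕ → V) (y : ℕ → W) : conv B x (-y) = -conv B x y := by
  funext n
  simp [conv]

lemma conv_smul_left (c : ℂ) (x : ℕ → V) (y : ℕ → W) : conv B (c • x) y = c • conv B x y := by
  funext n
  simp [conv, Finset.smul_sum]

lemma conv_smul_right (c : ℂ) (x : ℕ → V) (y : ℕ → W) : conv B x (c • y) = c • conv B x y := by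
  funext n
  simp [conv, Finset.smul_sum]

lemma TameOn.convolution {S : Set ℝ} {x : ℝ → ℕ → V} {y : ℝ → ℕ → W}
    (hx : ∀ n, TameOn S (fun s => x s n)) (hy : ∀ n, TameOn S (fun s => y s n)) (n : ℕ) :
    TameOn S (fun s => conv B (x s) (y s) n) :=
  .sum _ fun p _ => (hx p.1).bilin B (hy p.2)

lemma TameDeriv.convolution {S : Set ℝ} {x x' : ℝ → ℕ → V} {y y' : ℝ → ℕ → W}
    (hx : ∀ n, TameDeriv S (fun s => x s n) (fun s => x' s n))
    (hy : ∀ n, TameDeriv S (fun s => y s n) (fun s => y' s n)) (n : ℕ) :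
    TameDeriv S (fun s => conv B (x s) (y s) n)
      (fun s => (conv B (x' s) (y s) + conv B (x s) (y' s)) n) := by
  simp only [conv, Pi.add_apply, ← Finset.sum_add_distrib]
  exact .sum _ fun p _ => (hx p.1).bilin B (hy p.2)

lemma HasWeakIntegral.conv_right {a b : ℝ} (x : ℕ → V) {y : ℝ → ℕ → W} {I : ℕ → W}
    (h : ∀ n, HasWeakIntegral (fun r => y r n) a b (I n)) (n : ℕ) :
    HasWeakIntegral (fun r => conv B x (y r) n) a b (conv B x I n) :=
  .sum _ fun p _ => (h p.2).map (B (x p.1))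

lemma HasWeakIntegral.conv_left {a b : ℝ} {x : ℝ → ℕ → V} {I : ℕ → V} (y : ℕ → W)
    (h : ∀ n, HasWeakIntegral (fun r => x r n) a b (I n)) (n : ℕ) :
    HasWeakIntegral (fun r => conv B (x r) y n) a b (conv B I y n) :=
  .sum _ fun p _ => (h p.1).map (B.flip (y p.2))

end Conv

end WeakCalculus

/-! ### Formal parallel transport: composition, inverses, dependence on the source -/

section FormalTransport

open Set MeasureTheory

variable {A : Type*} [Ring A] [Algebra ℂ A] {Y Y' : ℝ → A} {a b x y m : ℝ}

lemma formalTransport_zero (Y : ℝ → A) (x r : ℝ) : formalTransport Y x r 0 = 1 := by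
  rw [formalTransport]

lemma formalTransport_succ (Y : ℝ → A) (x r : ℝ) (n : ℕ) : formalTransport Y x r (n + 1) =
    weakIntegral (fun u => Y u * formalTransport Y x u n) x r := by
  rw [formalTransport]

lemma formalTransport_self (Y : ℝ → A) (x : ℝ) : formalTransport Y x x = Pi.single 0 1 := by
  funext n
  cases n with
  | zero => simp [formalTransport_zero]
  | succ n => simp [formalTransport_succ, HasWeakIntegral.refl.eq]

lemma TameOn.tameOn_formalTransport (hY : TameOn (Icc a b) Y) (hx : x ∈ Icc a b) (n : ℕ) :
    TameOn (Icc a b) (fun r => formalTransport Y x r n) := by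
  induction n with
  | zero => simpa [formalTransport_zero] using TameOn.const (1 : A)
  | succ n ih =>
    simp only [formalTransport_succ]
    exact ((hY.bilin (LinearMap.mul ℂ A) ih).primitive hx).tameOn

/-- The series `Pi.single 1 (Y r)` is `ħ Y`, so this is the transport equation in every degree at
once. -/
lemma TameOn.formalTransport_deriv (hY : TameOn (Icc a b) Y) (hx : x ∈ Icc a b) (n : ℕ) :
    TameDeriv (Icc a b) (fun r => formalTransport Y x r n)
      (fun r => conv (LinearMap.mul ℂ A) (Pi.single 1 (Y r)) (formalTransport Y x r) n) := by
  cases n with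
  | zero => simpa [formalTransport_zero, conv_apply_zero] using TameDeriv.const (1 : A)
  | succ n =>
    simp only [formalTransport_succ, conv_single_one_left_succ]
    exact (hY.bilin (LinearMap.mul ℂ A) (hY.tameOn_formalTransport hx n)).primitive hx

/-- All the integrals in the definition of the transport from `x` to `y` exist. -/
def Transportable (Y : ℝ → A) (x y : ℝ) : Prop :=
  ∀ n, ∀ u ∈ uIcc x y, WeakIntegrable (fun r => Y r * formalTransport Y x r n) x u

lemma TameOn.transportable (hY : TameOn (Icc a b) Y) (hx : x ∈ Icc a b) (hy : y ∈ Icc a b) :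
    Transportable Y x y := fun n _ hu =>
  (hY.bilin (LinearMap.mul ℂ A) (hY.tameOn_formalTransport hx n)).weakIntegrable hx
    (ordConnected_Icc.uIcc_subset hx hy hu)

lemma uIoo_subset_uIoo_of_mem {x y u : ℝ} (hu : u ∈ uIcc x y) : uIoo x u ⊆ uIoo x y := by
  intro r hr
  rw [mem_uIcc] at hu
  simp only [uIoo, mem_Ioo, inf_lt_iff, lt_sup_iff] at hr ⊢
  rcases hu with hu | hu <;> rcases hr with ⟨h1 | h1, h2 | h2⟩ <;> constructor <;>
    first
    | (left; linarith)
    | (right; linarith)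

lemma uIoo_subset_uIcc_of_mem {x y u : ℝ} (hu : u ∈ uIcc x y) : uIoo x u ⊆ uIcc x y :=
  (uIoo_subset_uIoo_of_mem hu).trans Ioo_subset_Icc_self

lemma formalTransport_congr (h : EqOn Y Y' (uIoo x y)) (n : ℕ) :
    ∀ u ∈ uIcc x y, formalTransport Y x u n = formalTransport Y' x u n := by
  induction n with
  | zero => simp [formalTransport_zero]
  | succ n ih =>
    intro u hu
    rw [formalTransport_succ, formalTransport_succ]
    refine weakIntegral_congr fun r hr => ?_
    simp only [h (uIoo_subset_uIoo_of_mem hu hr), ih r (uIoo_subset_uIcc_of_mem hu hr)]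

lemma Transportable.congr (hY : Transportable Y x y) (h : EqOn Y Y' (uIoo x y)) :
    Transportable Y' x y := by
  intro n u hu
  obtain ⟨I, hI⟩ := hY n u hu
  refine ⟨I, hI.congr fun r hr => ?_⟩
  simp only [h (uIoo_subset_uIoo_of_mem hu hr),
    formalTransport_congr h n r (uIoo_subset_uIcc_of_mem hu hr)]

/-- Induction on the degree: the part of the integral from `x` to `m` gives the term of the Cauchy
product with trivial left factor, and the part from `m` to `u` gives all the others. The hypothesis
is `Transportable` rather than tameness because the connection along `P_V(s, ·)` is tame only
piecewise. The times need not be ordered, and returning to `x` yields inverses. -/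
lemma formalTransport_comp (h : Transportable Y x m) (h' : Transportable Y m y) (n : ℕ) :
    ∀ u ∈ uIcc m y, formalTransport Y x u n =
      conv (LinearMap.mul ℂ A) (formalTransport Y m u) (formalTransport Y x m) n := by
  induction n with
  | zero => simp [formalTransport_zero, conv_apply_zero]
  | succ n ih =>
    intro u hu
    have h1 := (h n m right_mem_uIcc).hasWeakIntegral
    have h2 : HasWeakIntegral (fun r => Y r * formalTransport Y x r n) m u
        (∑ p ∈ Finset.HasAntidiagonal.antidiagonal n,
          formalTransport Y m u (p.1 + 1) * formalTransport Y x m p.2) := by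
      refine (HasWeakIntegral.sum (Finset.HasAntidiagonal.antidiagonal n)
        (φ := fun p r => Y r * formalTransport Y m r p.1 * formalTransport Y x m p.2)
        fun p _ => ?_).congr fun r hr => ?_
      · rw [formalTransport_succ]
        exact (h' p.1 u hu).hasWeakIntegral.map
          ((LinearMap.mul ℂ A).flip (formalTransport Y x m p.2))
      · simp only [ih r (uIoo_subset_uIcc_of_mem hu hr), conv, Finset.mul_sum, mul_assoc,
          LinearMap.mul_apply']
    rw [formalTransport_succ, (h1.trans h2).eq, ← formalTransport_succ, conv,
      Finset.Nat.antidiagonal_succ]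
    simp [formalTransport_zero]

lemma TameOn.formalTransport_inv (hY : TameOn (Icc a b) Y) (hx : x ∈ Icc a b)
    (hy : y ∈ Icc a b) : conv (LinearMap.mul ℂ A) (formalTransport Y y x)
      (formalTransport Y x y) = Pi.single 0 1 := by
  rw [← formalTransport_self Y x]
  funext n
  exact (formalTransport_comp (hY.transportable hx hy) (hY.transportable hy hx) n x
    right_mem_uIcc).symm

lemma conv_mul_assoc (x y z : ℕ → A) : conv (LinearMap.mul ℂ A) (conv (LinearMap.mul ℂ A) x y) z =
    conv (LinearMap.mul ℂ A) x (conv (LinearMap.mul ℂ A) y z) :=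
  conv_assoc _ _ _ _ (fun _ _ _ => by simp [mul_assoc]) x y z

lemma conv_mul_one (x : ℕ → A) : conv (LinearMap.mul ℂ A) x (Pi.single 0 1) = x := by
  funext n
  simp [conv_single_zero_right]

lemma conv_one_mul (x : ℕ → A) : conv (LinearMap.mul ℂ A) (Pi.single 0 1) x = x := by
  funext n
  simp [conv_single_zero_left]

/-- The formal power series with `W(x) = 1` and `dW/ds = -ħ W Y`. -/
noncomputable def backwardTransport (Y : ℝ → A) (x : ℝ) : ℝ → ℕ → A
  | _, 0 => 1
  | s, n + 1 => -weakIntegral (fun u => backwardTransport Y x u n * Y u) x s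

lemma TameOn.deriv_backwardTransport (hY : TameOn (Icc a b) Y) (hx : x ∈ Icc a b) (n : ℕ) :
    TameDeriv (Icc a b) (fun s => backwardTransport Y x s n)
      (fun s => (-conv (LinearMap.mul ℂ A) (backwardTransport Y x s) (Pi.single 1 (Y s))) n) := by
  induction n with
  | zero =>
    simpa [backwardTransport, conv_apply_zero] using TameDeriv.const (1 : A)
  | succ n ih =>
    simp only [backwardTransport, Pi.neg_apply, conv_single_one_right_succ]
    exact ((ih.tameOn.bilin (LinearMap.mul ℂ A) hY).primitive hx).neg

/-- The recursion for the transport runs in its final time and gives no direct access to the initial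
one. The backward series times the forward transport has zero derivative and equals `1` at `x`, so
it is a left inverse of the forward transport. The reverse transport is a two-sided inverse, hence
the two agree. -/
lemma TameOn.backwardTransport_eq (hY : TameOn (Icc a b) Y) (hx : x ∈ Icc a b)
    (hy : y ∈ Icc a b) : backwardTransport Y x y = formalTransport Y y x := by
  have h1 : conv (LinearMap.mul ℂ A) (backwardTransport Y x y)
      (formalTransport Y x y) = Pi.single 0 1 := by
    funext n
    have h := TameDeriv.convolution (LinearMap.mul ℂ A) (hY.deriv_backwardTransport hx)
      (hY.formalTransport_deriv hx) n
    have h2 := (h.congr (fun _ _ => rfl) (ψ' := fun _ => 0) fun s _ => by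
      rw [conv_neg_left, conv_mul_assoc]
      simp).eq_of_zero hx hy
    refine h2.trans ?_
    rw [formalTransport_self, conv_mul_one]
    cases n with
    | zero => simp [backwardTransport]
    | succ n => simp [backwardTransport, HasWeakIntegral.refl.eq]
  rw [← conv_mul_one (backwardTransport Y x y), ← hY.formalTransport_inv hy hx,
    ← conv_mul_assoc, h1, conv_one_mul]

lemma TameOn.formalTransport_deriv_source (hY : TameOn (Icc a b) Y) (hx : x ∈ Icc a b) (n : ℕ) :
    TameDeriv (Icc a b) (fun s => formalTransport Y s x n)
      (fun s => (-conv (LinearMap.mul ℂ A) (formalTransport Y s x)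
        (Pi.single 1 (Y s))) n) :=
  (hY.deriv_backwardTransport hx n).congr (fun s hs => by simp only [hY.backwardTransport_eq hx hs])
    (fun s hs => by simp only [hY.backwardTransport_eq hx hs])

/-- The values `U' r • X` commute with each other, so the transport is the exponential series of `ħ
(U s - U x) X`. -/
lemma formalTransport_smul_const {U U' : ℝ → ℂ} {X : A}
    (hU : ∀ s ∈ Icc a b, HasDerivWithinAt U (U' s) (Icc a b) s) (hU' : ContinuousOn U' (Icc a b))
    (hx : x ∈ Icc a b) (n : ℕ) : ∀ s ∈ Icc a b,
      formalTransport (fun r => U' r • X) x s n = ((U s - U x) ^ n / n.factorial) • X ^ n := by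
  induction n with
  | zero => simp [formalTransport_zero]
  | succ n ih =>
    intro s hs
    have hd : TameDeriv (Icc a b)
        (fun s => ((U s - U x) ^ (n + 1) / (n + 1).factorial) • X ^ (n + 1))
        (fun s => U' s • X * ((U s - U x) ^ n / n.factorial) • X ^ n) := by
      refine (TameDeriv.smul _ _ (X ^ (n + 1)) fun s hs =>
        ((((hU s hs).sub_const (U x)).pow (n + 1)).div_const _)).congr (fun _ _ => rfl)
        fun s _ => ?_
      simp only [smul_mul_smul_comm, ← pow_succ']
      congr 1
      have := Nat.factorial_ne_zero n
      rw [Nat.factorial_succ]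
      push_cast
      field_simp
    have hUc : ContinuousOn U (Icc a b) := fun s hs => (hU s hs).continuousWithinAt
    have ht : TameOn (Icc a b) (fun s => U' s • X * ((U s - U x) ^ n / n.factorial) • X ^ n) := by
      simp only [smul_mul_smul_comm]
      exact .smul _ _ (hU'.mul (((hUc.sub continuousOn_const).pow n).div_const _))
    have := (hd.hasWeakIntegral ht hx hs).eq
    simp only [sub_self, ne_eq, Nat.add_eq_zero_iff, one_ne_zero, and_false, not_false_eq_true,
      zero_pow, zero_div, zero_smul, sub_zero] at this
    rw [formalTransport_succ, ← this]
    refine weakIntegral_congr fun r hr => ?_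
    have hr' : r ∈ Icc a b :=
      ordConnected_Icc.uIcc_subset hx hs (Ioo_subset_Icc_self hr)
    simp only [ih r hr']

lemma weakIntegral_comp_two_mul {V : Type*} [AddCommGroup V] [Module ℂ V] {φ : ℝ → V} {s : ℝ}
    (h : WeakIntegrable φ 0 s) :
    weakIntegral (fun u => (2 : ℂ) • φ (2 * u)) 0 (s / 2) = weakIntegral φ 0 s := by
  refine HasWeakIntegral.eq fun ℓ => ?_
  obtain ⟨h1, h2⟩ := h.hasWeakIntegral ℓ
  simp only [map_smul, smul_eq_mul]
  constructor
  · simpa using (h1.comp_mul_left (c := 2)).const_mul 2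
  · rw [intervalIntegral.integral_const_mul,
      intervalIntegral.integral_comp_mul_left (fun u => ℓ (φ u)) two_ne_zero, ← h2,
      mul_div_cancel₀ s two_ne_zero]
    simp

/-- Invariance under reparametrisation by `u ↦ 2u`, the speed at which `p_←` is traversed. -/
lemma TameOn.formalTransport_comp_two_mul (hY : TameOn (Icc 0 b) Y) (n : ℕ) :
    ∀ s ∈ Icc 0 b, formalTransport (fun u => (2 : ℂ) • Y (2 * u)) 0 (s / 2) n =
      formalTransport Y 0 s n := by
  induction n with
  | zero => simp [formalTransport_zero]
  | succ n ih =>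
    intro s hs
    have h0 : (0 : ℝ) ∈ Icc 0 b := ⟨le_rfl, hs.1.trans hs.2⟩
    rw [formalTransport_succ, formalTransport_succ,
      ← weakIntegral_comp_two_mul (hY.transportable h0 hs n s right_mem_uIcc)]
    refine weakIntegral_congr fun r hr => ?_
    rw [uIoo_of_le (by linarith [hs.1])] at hr
    have := ih (2 * r) ⟨by linarith [hr.1], by linarith [hr.2, hs.2]⟩
    rw [mul_div_cancel_left₀ _ two_ne_zero] at this
    simp only [this, smul_mul_assoc]

end FormalTransport

/-! ### The two actions on the bimodule as bilinear maps -/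

section Bimodule

variable {A M : Type*} [Ring A] [Algebra ℂ A] [AddCommGroup M] [Module ℂ M] [Module A M]
  [Module Aᵐᵒᵖ M] [IsScalarTower ℂ A M] [IsScalarTower ℂ Aᵐᵒᵖ M]

variable (A M) in
/-- The left action as a bilinear map. -/
noncomputable def leftAction : A →ₗ[ℂ] M →ₗ[ℂ] M :=
  LinearMap.mk₂ ℂ (fun x m => x • m) add_smul (fun c x m => smul_assoc c x m) smul_add
    (fun c x m => (smul_algebra_smul_comm c x m))

variable (A M) in
/-- The right action as a bilinear map. -/
noncomputable def rightAction : M →ₗ[ℂ] A →ₗ[ℂ] M :=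
  LinearMap.mk₂ ℂ (fun m x => MulOpposite.op x • m) (fun m m' x => smul_add _ m m')
    (fun c m x => (smul_algebra_smul_comm c (MulOpposite.op x) m))
    (fun m x y => by rw [MulOpposite.op_add, add_smul])
    (fun c m x => by rw [MulOpposite.op_smul, smul_assoc])

@[simp] lemma leftAction_apply (x : A) (m : M) : leftAction A M x m = x • m := rfl

@[simp] lemma rightAction_apply (m : M) (x : A) : rightAction A M m x = MulOpposite.op x • m := rfl

lemma leftMul_eq (x : ℕ → A) (m : ℕ → M) : leftMul x m = conv (leftAction A M) x m := rfl

lemma rightMul_eq (m : ℕ → M) (x : ℕ → A) : rightMul m x = conv (rightAction A M) m x := rfl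

lemma conv_leftAction_mul (x y : ℕ → A) (m : ℕ → M) :
    conv (leftAction A M) (conv (LinearMap.mul ℂ A) x y) m =
      conv (leftAction A M) x (conv (leftAction A M) y m) :=
  conv_assoc _ _ _ _ (fun _ _ _ => by simp [mul_smul]) x y m

lemma conv_rightAction_mul (m : ℕ → M) (x y : ℕ → A) :
    conv (rightAction A M) (conv (rightAction A M) m x) y =
      conv (rightAction A M) m (conv (LinearMap.mul ℂ A) x y) :=
  conv_assoc _ _ _ _ (fun _ _ _ => by simp [mul_smul]) m x y

lemma conv_leftAction_rightAction [SMulCommClass A Aᵐᵒᵖ M] (x : ℕ → A) (m : ℕ → M) (y : ℕ → A) :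
    conv (rightAction A M) (conv (leftAction A M) x m) y =
      conv (leftAction A M) x (conv (rightAction A M) m y) :=
  conv_assoc _ _ _ _ (fun x m y => by simp [smul_comm x]) x m y

lemma conv_leftAction_one (m : ℕ → M) : conv (leftAction A M) (Pi.single 0 1) m = m := by
  funext n
  simp [conv_single_zero_left]

end Bimodule

/-! ### Scalar coefficients: logarithms, iterated integrals and logarithmic derivatives along the
paths -/

section Coefficients

open Set MeasureTheory

lemma cI_mem_Ioo {ε s : ℝ} (hε : 0 < ε) (hε' : ε ≤ 1 / 4) (hs : s ∈ Icc (0 : ℝ) 1) :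
    cI ε s ∈ Ioo (0 : ℝ) 1 := by
  obtain ⟨h0, h1⟩ := hs
  unfold cI
  constructor <;> nlinarith

lemma hasDerivAt_cI (ε s : ℝ) : HasDerivAt (cI ε) (1 - 2 * ε) s := by
  exact (((hasDerivAt_id s).mul_const (1 - 2 * ε)).const_add ε).congr_deriv (one_mul _)

lemma continuous_cI (ε : ℝ) : Continuous (cI ε) := by
  unfold cI
  fun_prop

lemma continuousOn_Ω (i : Fin 2) : ContinuousOn (Ω i) (Ioo 0 1) := by
  unfold Ω
  refine continuousOn_const.div (by fun_prop) fun x hx => ?_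
  rw [sub_ne_zero]
  fin_cases i
  · simpa using hx.1.ne'
  · simpa using hx.2.ne

/-- The coefficient function of the pullback of `Ω i` along `c_I`. -/
noncomputable def coeff (ε : ℝ) (i : Fin 2) (s : ℝ) : ℂ := Ω i (cI ε s) * (1 - 2 * ε)

variable {ε : ℝ}

lemma continuousOn_coeff (hε : 0 < ε) (hε' : ε ≤ 1 / 4) (i : Fin 2) :
    ContinuousOn (coeff ε i) (Icc 0 1) :=
  ((continuousOn_Ω i).comp (continuous_cI ε).continuousOn
    fun _ hs => cI_mem_Ioo hε hε' hs).mul continuousOn_const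

lemma hasDerivAt_log_one_sub (hε : ε ∈ Ioo (0 : ℝ) 1) {x : ℝ} (hx : x ∈ Ioo (0 : ℝ) 1) :
    HasDerivAt (fun x : ℝ => (Real.log ((1 - x) / (1 - ε)) : ℂ)) (Ω 1 x) x := by
  have h1 : 1 - x ≠ 0 := by linarith [hx.2]
  have h2 : 1 - ε ≠ 0 := by linarith [hε.2]
  have h := ((((hasDerivAt_id x).const_sub 1).div_const (1 - ε)).log
    (div_ne_zero h1 h2)).ofReal_comp
  refine h.congr_deriv ?_
  have h3 : (1 - x : ℂ) ≠ 0 := by exact_mod_cast h1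
  have h4 : (1 - ε : ℂ) ≠ 0 := by exact_mod_cast h2
  have h5 : (x - 1 : ℂ) ≠ 0 := by rwa [← neg_ne_zero, neg_sub]
  simp only [Ω, id, Fin.val_one]
  push_cast
  field_simp
  ring

/-- `ln((1 - c_I(s)) / (1 - ε))`. -/
noncomputable def logV (ε s : ℝ) : ℂ := Real.log ((1 - cI ε s) / (1 - ε))

lemma mem_Ioo_of_le_quarter (hε : 0 < ε) (hε' : ε ≤ 1 / 4) : ε ∈ Ioo (0 : ℝ) 1 :=
  ⟨hε, by linarith⟩

lemma hasDerivAt_logV (hε : 0 < ε) (hε' : ε ≤ 1 / 4) {s : ℝ} (hs : s ∈ Icc (0 : ℝ) 1) :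
    HasDerivAt (logV ε) (coeff ε 1 s) s := by
  have h := (hasDerivAt_log_one_sub (mem_Ioo_of_le_quarter hε hε')
    (cI_mem_Ioo hε hε' hs)).scomp s (hasDerivAt_cI ε s)
  refine h.congr_deriv ?_
  simp [coeff, mul_comm]

lemma logV_zero (hε' : ε ≤ 1 / 4) : logV ε 0 = 0 := by
  have : 1 - ε ≠ 0 := by linarith
  simp [logV, cI, this]

section IterIntegral

variable {x : ℝ} {ω : List (ℝ → ℂ)}

lemma iterIntegral_self (f : ℝ → ℂ) : iterIntegral x (f :: ω) x = 0 := by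
  simp [iterIntegral]

lemma hasDerivAt_iterIntegral_aux (hε : ε ∈ Ioo (0 : ℝ) 1) {f : ℝ → ℂ}
    (hf : ContinuousOn f (Ioo 0 1)) (h : ContinuousOn (iterIntegral ε ω) (Ioo 0 1))
    (hx : x ∈ Ioo (0 : ℝ) 1) :
    HasDerivAt (iterIntegral ε (f :: ω)) (f x * iterIntegral ε ω x) x := by
  have hc := hf.mul h
  have : iterIntegral ε (f :: ω) = fun b => ∫ s in ε..b, f s * iterIntegral ε ω s := by
    funext b
    rw [iterIntegral]
  rw [this]
  exact intervalIntegral.integral_hasDerivAt_right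
    (hc.mono (ordConnected_Ioo.uIcc_subset hε hx)).intervalIntegrable
    (hc.stronglyMeasurableAtFilter isOpen_Ioo x hx) (hc.continuousAt (isOpen_Ioo.mem_nhds hx))

lemma continuousOn_iterIntegral (hε : ε ∈ Ioo (0 : ℝ) 1)
    (hω : ∀ f ∈ ω, ContinuousOn f (Ioo 0 1)) : ContinuousOn (iterIntegral ε ω) (Ioo 0 1) := by
  induction ω with
  | nil =>
    have : iterIntegral ε [] = fun _ => 1 := by
      funext b
      rw [iterIntegral]
    rw [this]
    exact continuousOn_const
  | cons f ω ih =>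
    exact fun x hx => (hasDerivAt_iterIntegral_aux hε (hω f (by simp))
      (ih fun g hg => hω g (by simp [hg])) hx).continuousAt.continuousWithinAt

lemma hasDerivAt_iterIntegral (hε : ε ∈ Ioo (0 : ℝ) 1) {f : ℝ → ℂ}
    (hω : ∀ g ∈ f :: ω, ContinuousOn g (Ioo 0 1)) (hx : x ∈ Ioo (0 : ℝ) 1) :
    HasDerivAt (iterIntegral ε (f :: ω)) (f x * iterIntegral ε ω x) x :=
  hasDerivAt_iterIntegral_aux hε (hω f (by simp))
    (continuousOn_iterIntegral hε fun g hg => hω g (by simp [hg])) hx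

/-- `Ω₁` is the differential of `ln((1 - x) / (1 - ε))`, which vanishes at `ε`, so repeating the
letter produces divided powers. This identifies the logarithms of the ODE source with iterated
integrals. -/
lemma iterIntegral_replicate (hε : ε ∈ Ioo (0 : ℝ) 1) (k : ℕ) :
    ∀ x ∈ Ioo (0 : ℝ) 1, iterIntegral ε (List.replicate k (Ω 1)) x =
      (Real.log ((1 - x) / (1 - ε)) : ℂ) ^ k / (k.factorial : ℂ) := by
  induction k with
  | zero => simp [iterIntegral]
  | succ k ih =>
    intro x hx
    have hS : uIcc ε x ⊆ Ioo 0 1 := ordConnected_Ioo.uIcc_subset hε hx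
    have hk : ((k + 1 : ℕ) : ℂ) ≠ 0 := by exact_mod_cast k.succ_ne_zero
    have hf : (k.factorial : ℂ) ≠ 0 := by exact_mod_cast k.factorial_ne_zero
    have hd : ∀ s ∈ uIcc ε x, HasDerivAt
        (fun x : ℝ => (Real.log ((1 - x) / (1 - ε)) : ℂ) ^ (k + 1) / ((k + 1).factorial : ℂ))
        (Ω 1 s * ((Real.log ((1 - s) / (1 - ε)) : ℂ) ^ k / (k.factorial : ℂ))) s := by
      intro s hs
      refine (((hasDerivAt_log_one_sub hε (hS hs)).pow (k + 1)).div_const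
        ((k + 1).factorial : ℂ)).congr_deriv ?_
      rw [Nat.factorial_succ]
      push_cast at hk ⊢
      field_simp
    have hc : ContinuousOn (fun s : ℝ =>
        Ω 1 s * ((Real.log ((1 - s) / (1 - ε)) : ℂ) ^ k / (k.factorial : ℂ))) (uIcc ε x) := by
      refine ((continuousOn_Ω 1).mono hS).mul (ContinuousOn.div_const (ContinuousOn.pow ?_ k) _)
      exact fun s hs => (hasDerivAt_log_one_sub hε (hS hs)).continuousAt.continuousWithinAt
    rw [List.replicate_succ, iterIntegral, intervalIntegral.integral_congr
      (g := fun s => Ω 1 s * ((Real.log ((1 - s) / (1 - ε)) : ℂ) ^ k / (k.factorial : ℂ)))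
      fun s hs => by simp only [ih s (hS hs)],
      intervalIntegral.integral_eq_sub_of_hasDerivAt hd hc.intervalIntegrable]
    have : 1 - ε ≠ 0 := by linarith [hε.2]
    simp [this]

lemma hasDerivWithinAt_iterIntegral_cI (hε : 0 < ε) (hε' : ε ≤ 1 / 4) {i : Fin 2}
    (hω : ∀ g ∈ ω, ContinuousOn g (Ioo 0 1)) {s : ℝ} (hs : s ∈ Icc (0 : ℝ) 1) :
    HasDerivWithinAt (fun s => iterIntegral ε (Ω i :: ω) (cI ε s))
      (coeff ε i s * iterIntegral ε ω (cI ε s)) (Icc 0 1) s := by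
  have h := (hasDerivAt_iterIntegral (f := Ω i) (ω := ω) (mem_Ioo_of_le_quarter hε hε') (by
    rintro g hg
    rcases List.mem_cons.1 hg with rfl | hg
    · exact continuousOn_Ω i
    · exact hω g hg) (cI_mem_Ioo hε hε' hs)).scomp s (hasDerivAt_cI ε s)
  refine HasDerivAt.hasDerivWithinAt ?_
  refine h.congr_deriv ?_
  simp [coeff]
  ring

end IterIntegral

section Path

variable {a : ℂ} {s : ℝ}

lemma cVι_eq (ε s : ℝ) : cVι ε s = 1 - 1 / (1 - cI ε s : ℂ) := by
  unfold cVι cI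
  push_cast
  ring_nf

lemma one_sub_cI_ne_zero (hε : 0 < ε) (hε' : ε ≤ 1 / 4) (hs : s ∈ Icc (0 : ℝ) 1) :
    (1 - cI ε s : ℂ) ≠ 0 := by
  exact_mod_cast (sub_pos.2 (cI_mem_Ioo hε hε' hs).2).ne'

lemma cI_ne_zero (hε : 0 < ε) (hε' : ε ≤ 1 / 4) (hs : s ∈ Icc (0 : ℝ) 1) :
    (cI ε s : ℂ) ≠ 0 := by
  exact_mod_cast (cI_mem_Ioo hε hε' hs).1.ne'

lemma hasDerivAt_one_sub_cI (ε s : ℝ) :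
    HasDerivAt (fun s => (1 - cI ε s : ℂ)) (-(1 - 2 * ε)) s := by
  simpa using (hasDerivAt_cI ε s).ofReal_comp.const_sub 1

lemma hasDerivAt_cVι (hε : 0 < ε) (hε' : ε ≤ 1 / 4) (hs : s ∈ Icc (0 : ℝ) 1) :
    HasDerivAt (cVι ε) (-(1 - 2 * ε) / (1 - cI ε s : ℂ) ^ 2) s := by
  have h := ((hasDerivAt_one_sub_cI ε s).inv (one_sub_cI_ne_zero hε hε' hs)).const_sub 1
  have : cVι ε = fun s => 1 - (1 - cI ε s : ℂ)⁻¹ := by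
    funext s
    rw [cVι_eq, one_div]
  rw [this]
  refine h.congr_deriv ?_
  ring

/-- Logarithmic derivatives of `z = -c / (1 - c)` and `z - 1 = -1 / (1 - c)`, with `c = c_I(s)`. -/
lemma cVι_div (hε : 0 < ε) (hε' : ε ≤ 1 / 4) (hs : s ∈ Icc (0 : ℝ) 1) :
    deriv (cVι ε) s / cVι ε s = coeff ε 0 s - coeff ε 1 s ∧
      deriv (cVι ε) s / (cVι ε s - 1) = -coeff ε 1 s := by
  have h0 := cI_ne_zero hε hε' hs
  have h1 := one_sub_cI_ne_zero hε hε' hs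
  have h2 : (cI ε s - 1 : ℂ) ≠ 0 := by rwa [← neg_ne_zero, neg_sub]
  have h3 : cVι ε s = -cI ε s / (1 - cI ε s) := by
    rw [cVι_eq]
    field_simp
    ring
  have h4 : cVι ε s - 1 = -1 / (1 - cI ε s) := by
    rw [cVι_eq]
    field_simp
    ring
  rw [(hasDerivAt_cVι hε hε' hs).deriv, h4, h3]
  simp only [coeff, Ω, Fin.val_zero, Fin.val_one, Nat.cast_zero, Nat.cast_one, sub_zero]
  constructor
  · rw [← neg_sub (1 : ℂ) (cI ε s)]
    field_simp
    ring
  · rw [← neg_sub (1 : ℂ) (cI ε s)]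
    field_simp

lemma hasDerivAt_pV (hε : 0 < ε) (hε' : ε ≤ 1 / 4) (a : ℂ) (hs : s ∈ Icc (0 : ℝ) 1) :
    HasDerivAt (pV ε a) (deriv (cVι ε) s, -(1 - 2 * ε) / (1 - ε) * a) s := by
  have h := (hasDerivAt_cVι hε hε' hs)
  refine (h.differentiableAt.hasDerivAt).prodMk ?_
  exact ((hasDerivAt_one_sub_cI ε s).div_const _).mul_const a

lemma hasDerivAt_pLeft (hε : 0 < ε) (hε' : ε ≤ 1 / 4) (a : ℂ) (hs : 2 * s ∈ Icc (0 : ℝ) 1) :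
    HasDerivAt (pLeft ε a) (2 * deriv (cVι ε) (2 * s), 0) s := by
  refine HasDerivAt.prodMk ?_ (hasDerivAt_const _ _)
  have h := (hasDerivAt_cVι hε hε' hs).differentiableAt.hasDerivAt.scomp s
    ((hasDerivAt_id s).const_mul 2)
  simpa [Function.comp_def] using h

end Path

end Coefficients

/-! ### The pulled-back connections and the differential equation for `f_V` -/

namespace KZGenerators

open Set MeasureTheory

variable {A M : Type*} [Ring A] [Algebra ℂ A] [AddCommGroup M] [Module ℂ M] [Module A M]
  [Module Aᵐᵒᵖ M] (D : KZGenerators A M) {ε s : ℝ} {a : ℂ}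

/-- The pullback of `Γ` along `c_V ∘ ι`. -/
noncomputable def formLeft (ε s : ℝ) : A := coeff ε 0 s • D.t12 + coeff ε 1 s • D.t13bar

/-- The pullback of `∇` along `p_V`. -/
noncomputable def formV (ε s : ℝ) : A := D.formLeft ε s + coeff ε 1 s • D.Λ

/-- The origin of `t₁₃ - Λ`: in `(Ω₀ - Ω₁) t₁₂ - Ω₁ t₂₃` the coefficient of `Ω₁` is `-(t₁₂ + t₂₃)`.
-/
lemma Γ_cVι (hε : 0 < ε) (hε' : ε ≤ 1 / 4) (hs : s ∈ Icc (0 : ℝ) 1) :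
    D.Γ (cVι ε s) (deriv (cVι ε) s) = D.formLeft ε s := by
  obtain ⟨h1, h2⟩ := cVι_div hε hε' hs
  rw [Γ, h1, h2, formLeft, t13bar, Λ]
  module

/-- Along `p_V` the coordinate `v` is a constant multiple of `1 - c_I`, so `dv/v = Ω₁`. This is the
only difference from `formLeft`. -/
lemma nabla_pV (hε : 0 < ε) (hε' : ε ≤ 1 / 4) (ha : a ≠ 0) (hs : s ∈ Icc (0 : ℝ) 1) :
    D.nabla (pV ε a s) (deriv (pV ε a) s) = D.formV ε s := by
  rw [(hasDerivAt_pV hε hε' a hs).deriv, nabla, formV]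
  simp only [pV]
  rw [D.Γ_cVι hε hε' hs]
  congr 2
  have h1 := one_sub_cI_ne_zero hε hε' hs
  have h2 : (cI ε s - 1 : ℂ) ≠ 0 := by rwa [← neg_ne_zero, neg_sub]
  have h3 : (1 - ε : ℂ) ≠ 0 := by
    have : 1 - ε ≠ 0 := by linarith
    exact_mod_cast this
  simp only [coeff, Ω, Fin.val_one, Nat.cast_one]
  rw [← neg_sub (1 : ℂ) (cI ε s)]
  field_simp

lemma nabla_pLeft (hε : 0 < ε) (hε' : ε ≤ 1 / 4) (hs : 2 * s ∈ Icc (0 : ℝ) 1) :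
    D.nabla (pLeft ε a s) (deriv (pLeft ε a) s) = (2 : ℂ) • D.formLeft ε (2 * s) := by
  rw [(hasDerivAt_pLeft hε hε' a hs).deriv, nabla, ← D.Γ_cVι hε hε' hs]
  simp only [pLeft, Γ, zero_div, zero_smul, add_zero, smul_add, smul_smul, mul_div_assoc]

lemma tameOn_formLeft (hε : 0 < ε) (hε' : ε ≤ 1 / 4) : TameOn (Icc 0 1) (D.formLeft ε) :=
  (TameOn.smul _ _ (continuousOn_coeff hε hε' 0)).add
    (TameOn.smul _ _ (continuousOn_coeff hε hε' 1))

lemma tameOn_formV (hε : 0 < ε) (hε' : ε ≤ 1 / 4) : TameOn (Icc 0 1) (D.formV ε) :=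
  (D.tameOn_formLeft hε hε').add (TameOn.smul _ _ (continuousOn_coeff hε hε' 1))

lemma uIoo_subset_Icc {x y b c : ℝ} (hx : x ∈ Icc b c) (hy : y ∈ Icc b c) :
    uIoo x y ⊆ Icc b c :=
  Ioo_subset_Icc_self.trans (ordConnected_Icc.uIcc_subset hx hy)

lemma transportΓ_cVι (hε : 0 < ε) (hε' : ε ≤ 1 / 4) {x y : ℝ} (hx : x ∈ Icc (0 : ℝ) 1)
    (hy : y ∈ Icc (0 : ℝ) 1) :
    D.transportΓ (cVι ε) x y = formalTransport (D.formLeft ε) x y := by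
  funext n
  exact formalTransport_congr
    (fun r hr => D.Γ_cVι hε hε' (uIoo_subset_Icc hx hy hr)) n y right_mem_uIcc

lemma transport_pV (hε : 0 < ε) (hε' : ε ≤ 1 / 4) (ha : a ≠ 0) {x y : ℝ}
    (hx : x ∈ Icc (0 : ℝ) 1) (hy : y ∈ Icc (0 : ℝ) 1) :
    D.transport (pV ε a) x y = formalTransport (D.formV ε) x y := by
  funext n
  exact formalTransport_congr
    (fun r hr => D.nabla_pV hε hε' ha (uIoo_subset_Icc hx hy hr)) n y right_mem_uIcc

lemma transport_pLeft (hε : 0 < ε) (hε' : ε ≤ 1 / 4) (hs : s ∈ Icc (0 : ℝ) 1) :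
    D.transport (pLeft ε a) 0 (s / 2) = formalTransport (D.formLeft ε) 0 s := by
  funext n
  rw [← (D.tameOn_formLeft hε hε').formalTransport_comp_two_mul n s hs]
  refine formalTransport_congr (fun r hr => ?_) n _ right_mem_uIcc
  rw [uIoo_of_le (by linarith [hs.1])] at hr
  exact D.nabla_pLeft hε hε' ⟨by linarith [hr.1], by linarith [hr.2, hs.2]⟩

variable [IsScalarTower ℂ A M] [IsScalarTower ℂ Aᵐᵒᵖ M]

/-- `ad_x` as a linear map. -/
noncomputable def adLin (x : A) : M →ₗ[ℂ] M := leftAction A M x - (rightAction A M).flip x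

/-- `KZGenerators.op` as a linear map. -/
noncomputable def opLin (i : Fin 2) : M →ₗ[ℂ] M :=
  if i = 0 then adLin D.t12 else adLin D.t13bar + leftAction A M D.Λ

lemma op_eq (i : Fin 2) (m : M) : D.op i m = D.opLin i m := by
  rw [op, opLin]
  split_ifs <;> rfl

/-- The reason for the operators `T₀` and `T₁`: left multiplication by `formV` minus right
multiplication by `formLeft` gives commutators, except that the extra `Ω₁ Λ` acts from the left
only. The shift of degree is the factor `ħ` of both connections. -/
lemma coeff_smul_op (f : ℕ → M) (n : ℕ) : ∑ i, coeff ε i s • D.op i (f n) =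
    (conv (leftAction A M) (Pi.single 1 (D.formV ε s)) f -
      conv (rightAction A M) f (Pi.single 1 (D.formLeft ε s))) (n + 1) := by
  rw [Pi.sub_apply, conv_single_one_left_succ, conv_single_one_right_succ]
  simp only [Fin.sum_univ_two, op_eq, opLin, adLin, formV, formLeft, map_add, map_smul,
    LinearMap.add_apply, LinearMap.sub_apply, LinearMap.smul_apply, one_ne_zero, if_true, if_false,
    LinearMap.flip_apply]
  module

/-- The composite of the operators indexed by a word. -/
noncomputable def wordOp (i : List (Fin 2)) : M →ₗ[ℂ] M :=
  i.foldr (fun i T => D.opLin i ∘ₗ T) LinearMap.id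

lemma foldr_op (i : List (Fin 2)) (m : M) : i.foldr D.op m = D.wordOp i m := by
  induction i with
  | nil => rfl
  | cons i l ih =>
    rw [List.foldr_cons, ih, op_eq]
    rfl

/-- `KZGenerators.sandwich` as a linear map. -/
noncomputable def sandwichLin (i j : ℕ) : M →ₗ[ℂ] M :=
  leftAction A M (D.Λ ^ i) ∘ₗ (rightAction A M).flip (D.Λ ^ j)

lemma sandwich_eq (i j : ℕ) (m : M) : D.sandwich i j m = D.sandwichLin i j m := rfl

/-- By linearity the iterated integrals come out of the operators, so all dependence on `x` sits in
scalars. -/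
lemma fVTerm_eq (x : ℝ) (k j : ℕ) (i : List (Fin 2)) : D.fVTerm ε x k j i =
    iterIntegral ε (i.map Ω ++ Ω 0 :: List.replicate k (Ω 1)) x •
      D.wordOp i (D.sandwich j (k - 1 - j) D.L) -
    iterIntegral ε (i.map Ω ++ List.replicate (k + 1) (Ω 1)) x •
      D.wordOp i (D.sandwich j (k - 1 - j) (D.L + D.R)) := by
  rw [fVTerm, foldr_op, sandwich_eq, map_sub, map_smul, map_smul, map_sub, map_smul, map_smul]
  rfl

lemma continuousOn_of_mem_word {i : List (Fin 2)} {l : List (ℝ → ℂ)}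
    (hl : ∀ f ∈ l, ∃ i, f = Ω i) : ∀ f ∈ i.map Ω ++ l, ContinuousOn f (Ioo 0 1) := by
  intro f hf
  rcases List.mem_append.1 hf with hf | hf
  · obtain ⟨i, _, rfl⟩ := List.mem_map.1 hf
    exact continuousOn_Ω i
  · obtain ⟨i, rfl⟩ := hl f hf
    exact continuousOn_Ω i

/-- Differentiating an iterated integral removes its outermost letter, and the matching operator is
the outermost one. -/
lemma tameDeriv_fVTerm_cons (hε : 0 < ε) (hε' : ε ≤ 1 / 4) (k j : ℕ) (i : Fin 2)
    (l : List (Fin 2)) : TameDeriv (Icc 0 1) (fun s => D.fVTerm ε (cI ε s) k j (i :: l))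
      (fun s => coeff ε i s • D.op i (D.fVTerm ε (cI ε s) k j l)) := by
  simp only [fVTerm_eq, op_eq, List.map_cons, List.cons_append, wordOp, List.foldr_cons,
    LinearMap.comp_apply, map_sub, map_smul, smul_sub, smul_smul]
  refine TameDeriv.sub (.smul _ _ _ fun s hs => ?_) (.smul _ _ _ fun s hs => ?_)
  · exact hasDerivWithinAt_iterIntegral_cI hε hε' (continuousOn_of_mem_word fun f hf => by
      rcases List.mem_cons.1 hf with rfl | hf
      · exact ⟨0, rfl⟩
      · exact ⟨1, List.eq_of_mem_replicate hf⟩) hs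
  · exact hasDerivWithinAt_iterIntegral_cI hε hε' (continuousOn_of_mem_word fun f hf =>
      ⟨1, List.eq_of_mem_replicate hf⟩) hs

/-- With no word in front, the derivative removes the leading `Ω₀` or `Ω₁` and leaves `Ω₁^k`, a
divided power of the logarithm. The remaining `Ω₀ L - Ω₁ (L + R)` is the pullback of `(L/z +
R/(z-1)) dz`. -/
lemma tameDeriv_fVTerm_nil (hε : 0 < ε) (hε' : ε ≤ 1 / 4) (k j : ℕ) :
    TameDeriv (Icc 0 1) (fun s => D.fVTerm ε (cI ε s) k j [])
      (fun s => deriv (cVι ε) s • (logV ε s ^ k / (k.factorial : ℂ)) •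
        D.sandwich j (k - 1 - j) ((1 / cVι ε s) • D.L + (1 / (cVι ε s - 1)) • D.R)) := by
  have hc : ∀ f ∈ List.replicate k (Ω 1), ContinuousOn f (Ioo 0 1) := fun f hf => by
    rw [List.eq_of_mem_replicate hf]
    exact continuousOn_Ω 1
  simp only [fVTerm_eq, List.map_nil, List.nil_append, wordOp, List.foldr_nil,
    LinearMap.id_coe, id]
  refine (TameDeriv.sub
    (.smul _ _ (D.sandwich j (k - 1 - j) D.L) fun s hs => hasDerivWithinAt_iterIntegral_cI (i := 0) hε hε' hc hs)
    (.smul _ _ (D.sandwich j (k - 1 - j) (D.L + D.R)) fun s hs =>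
      hasDerivWithinAt_iterIntegral_cI (i := 1) hε hε' hc hs)).congr
    (fun s _ => by simp only [List.replicate_succ]) fun s hs => ?_
  obtain ⟨h1, h2⟩ := cVι_div hε hε' hs
  simp only [iterIntegral_replicate (mem_Ioo_of_le_quarter hε hε') k _ (cI_mem_Ioo hε hε' hs)]
  rw [smul_comm (deriv (cVι ε) s), sandwich_eq, sandwich_eq, sandwich_eq, ← map_smul _ (deriv _ _)]
  rw [smul_add, smul_smul, smul_smul, mul_one_div, mul_one_div, h1, h2, logV]
  simp only [map_add, map_smul]
  module

/-- The sum of the summands of `f_V` over the words of length `r`. -/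
noncomputable def fVSum (ε x : ℝ) (r k : ℕ) : M :=
  ∑ i : Fin r → Fin 2, ∑ j ∈ Finset.range k, D.fVTerm ε x k j (List.ofFn i)

lemma fVSum_zero_right (x : ℝ) (r : ℕ) : D.fVSum ε x r 0 = 0 := by
  simp [fVSum]

lemma fV_apply_zero : D.fV ε s 0 = 0 := by
  rw [fV, Finset.filter_false_of_mem]
  · simp
  · rintro q _ ⟨_, h⟩
    omega

/-- The terms with `k = 0` are empty sums over `j`. Adding them turns the index set into a full
antidiagonal. -/
lemma fV_apply_succ (n : ℕ) : D.fV ε s (n + 1) =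
    ∑ p ∈ Finset.HasAntidiagonal.antidiagonal n, D.fVSum ε (cI ε s) p.1 p.2 := by
  rw [fV]
  refine Finset.sum_subset_zero_on_sdiff (fun q hq => ?_) (fun q hq => ?_) fun _ _ => rfl
  · simp at hq ⊢
    omega
  · have : q.2 = 0 := by
      simp at hq
      omega
    rw [this, fVSum_zero_right]

lemma odeSource_succ (k : ℕ) : D.odeSource ε s (k + 1) = (logV ε s ^ k / (k.factorial : ℂ)) •
    ∑ j ∈ Finset.range k, D.sandwich j (k - 1 - j)
      ((1 / cVι ε s) • D.L + (1 / (cVι ε s - 1)) • D.R) := by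
  rcases k.eq_zero_or_pos with rfl | hk
  · rw [odeSource, Finset.filter_false_of_mem]
    · simp
    · intros
      omega
  · have : (Finset.range (k + 1 + 1)).filter (fun j => 1 ≤ j ∧ j + 1 = k + 1) = {k} := by
      ext j
      simp
      omega
    rw [odeSource, this, Finset.sum_singleton, logV]

lemma tameDeriv_fVSum_zero (hε : 0 < ε) (hε' : ε ≤ 1 / 4) (k : ℕ) :
    TameDeriv (Icc 0 1) (fun s => D.fVSum ε (cI ε s) 0 k)
      (fun s => deriv (cVι ε) s • D.odeSource ε s (k + 1)) := by
  have h := TameDeriv.sum (Finset.range k) fun j _ => D.tameDeriv_fVTerm_nil hε hε' k j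
  refine h.congr (fun s _ => by simp [fVSum]) fun s _ => ?_
  simp only [odeSource_succ, Finset.smul_sum]

lemma tameDeriv_fVSum_succ (hε : 0 < ε) (hε' : ε ≤ 1 / 4) (r k : ℕ) :
    TameDeriv (Icc 0 1) (fun s => D.fVSum ε (cI ε s) (r + 1) k)
      (fun s => ∑ i, coeff ε i s • D.op i (D.fVSum ε (cI ε s) r k)) := by
  have h := TameDeriv.sum Finset.univ fun i _ => TameDeriv.sum Finset.univ
    fun l (_ : l ∈ (Finset.univ : Finset (Fin r → Fin 2))) =>
      TameDeriv.sum (Finset.range k) fun j _ =>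
        D.tameDeriv_fVTerm_cons hε hε' k j i (List.ofFn l)
  refine h.congr (fun s _ => ?_) fun s _ => ?_
  · simp only [fVSum]
    -- A word of length `r + 1` is a first letter together with a word of length `r`.
    rw [← Fintype.sum_prod_type', ← (Fin.consEquiv fun _ => Fin 2).sum_comp]
    simp [Fin.consEquiv, List.ofFn_succ]
  · simp only [fVSum, op_eq, map_sum, Finset.smul_sum]

/-- The Picard equation `f' = ħ (formV f - f formLeft) + z' g`: empty words differentiate to the
source, and words with a first letter to the operator terms one degree lower. -/
lemma tameDeriv_fV (hε : 0 < ε) (hε' : ε ≤ 1 / 4) (n : ℕ) :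
    TameDeriv (Icc 0 1) (fun s => D.fV ε s n) (fun s =>
      (conv (leftAction A M) (Pi.single 1 (D.formV ε s)) (D.fV ε s) -
        conv (rightAction A M) (D.fV ε s) (Pi.single 1 (D.formLeft ε s)) +
        deriv (cVι ε) s • D.odeSource ε s) n) := by
  have h0 : ∀ s, D.odeSource ε s 0 = 0 := fun s => by simp [odeSource]
  rcases n with _ | n
  · simpa [fV_apply_zero, conv_apply_zero, h0] using TameDeriv.const (0 : M)
  simp only [Pi.add_apply, Pi.smul_apply, ← coeff_smul_op, fV_apply_succ]
  rcases n with _ | n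
  -- In degree `1` only `r = k = 0` occurs, so `f_V` and the source both vanish.
  · refine (D.tameDeriv_fVSum_zero hε hε' 0).congr (fun s _ => by simp) fun s _ => ?_
    simp [fV_apply_zero, op_eq]
  · refine ((D.tameDeriv_fVSum_zero hε hε' (n + 1)).add (TameDeriv.sum
      (Finset.HasAntidiagonal.antidiagonal n)
      fun p _ => D.tameDeriv_fVSum_succ hε hε' p.1 p.2)).congr (fun s _ => ?_) fun s _ => ?_
    -- The antidiagonal splits into its entry with `r = 0` and those with `r + 1`.
    · simp [Finset.Nat.antidiagonal_succ]
    · simp only [fV_apply_succ, op_eq, map_sum, Finset.smul_sum]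
      rw [Finset.sum_comm, add_comm]

lemma fV_start : D.fV ε 0 = 0 := by
  funext n
  rcases n with _ | n
  · exact D.fV_apply_zero
  · have hc : cI ε 0 = ε := by simp [cI]
    rw [fV_apply_succ, hc]
    refine Finset.sum_eq_zero fun p _ => Finset.sum_eq_zero fun i _ =>
      Finset.sum_eq_zero fun j _ => ?_
    rw [fVTerm_eq]
    rcases List.ofFn i with _ | ⟨_, _⟩ <;> simp [iterIntegral_self, List.replicate_succ]

end KZGenerators

/-! ### Beta integrals and a shift by `ħ²` -/

section BetaIntegral

open Set MeasureTheory

variable {V W X : Type*} [AddCommGroup V] [Module ℂ V] [AddCommGroup W] [Module ℂ W]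
  [AddCommGroup X] [Module ℂ X]

lemma TameOn.comp {S T : Set ℝ} {φ : ℝ → V} (h : TameOn S φ) {g : ℝ → ℝ}
    (hg : ContinuousOn g T) (hST : MapsTo g T S) : TameOn T (fun s => φ (g s)) := by
  induction h with
  | smul f v hf => exact .smul _ v (hf.comp hg hST)
  | add _ _ h h' => exact h.add h'
  | congr _ e h => exact h.congr fun s hs => e (hST hs)

lemma conv_sub_right (B : V →ₗ[ℂ] W →ₗ[ℂ] X) (x : ℕ → V) (y y' : ℕ → W) :
    conv B x (y - y') = conv B x y - conv B x y' := by
  rw [sub_eq_add_neg, conv_add_right, conv_neg_right, ← sub_eq_add_neg]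

lemma conv_sub_left (B : V →ₗ[ℂ] W →ₗ[ℂ] X) (x x' : ℕ → V) (y : ℕ → W) :
    conv B (x - x') y = conv B x y - conv B x' y := by
  rw [sub_eq_add_neg, conv_add_left, conv_neg_left, ← sub_eq_add_neg]

lemma conv_single_two_right (B : V →ₗ[ℂ] W →ₗ[ℂ] X) (x : ℕ → V) (w : W) :
    conv B x (Pi.single 2 w) 0 = 0 ∧ conv B x (Pi.single 2 w) 1 = 0 ∧
      ∀ n, conv B x (Pi.single 2 w) (n + 2) = B (x n) w := by
  have h : (fun i => (Pi.single 2 w : ℕ → W) (i + 1)) = Pi.single 1 w := by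
    funext i
    rcases i with _ | _ | i <;> simp
  refine ⟨by simp [conv_apply_zero], ?_, fun n => ?_⟩
  · rw [← zero_add 1, conv_zero_right_succ _ _ _ (by simp), h]
    simp [conv_apply_zero]
  · rw [conv_zero_right_succ _ _ _ (by simp), h, conv_single_one_right_succ]

/-- Integration by parts moves one power from `U - u` to `u`, down to the case `i = 0`. A primitive
on all of `ℂ` is produced so that the complex-valued logarithm along a path can be substituted into
it. -/
lemma exists_antideriv_beta (U : ℂ) (i : ℕ) : ∀ j : ℕ, ∃ G : ℂ → ℂ,
    (∀ u, HasDerivAt G ((U - u) ^ i / i.factorial * (u ^ j / j.factorial)) u) ∧ G 0 = 0 ∧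
      G U = U ^ (i + j + 1) / (i + j + 1).factorial := by
  have hp : ∀ (j : ℕ) (u : ℂ), HasDerivAt (fun u : ℂ => u ^ (j + 1) / (j + 1).factorial)
      (u ^ j / j.factorial) u := by
    intro j u
    refine (((hasDerivAt_id u).pow (j + 1)).div_const _).congr_deriv ?_
    have := Nat.factorial_ne_zero j
    rw [Nat.factorial_succ]
    push_cast
    field_simp
    simp
  induction i with
  | zero =>
    intro j
    exact ⟨fun u => u ^ (j + 1) / (j + 1).factorial, fun u => by simpa using hp j u, by simp,
      by simp⟩
  | succ i ih =>
    intro j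
    obtain ⟨G, h1, h2, h3⟩ := ih (j + 1)
    refine ⟨fun u => (U - u) ^ (i + 1) / (i + 1).factorial *
      (u ^ (j + 1) / (j + 1).factorial) + G u, fun u => ?_, by simp [h2], ?_⟩
    · have h := (((hp i (U - u)).comp u ((hasDerivAt_id u).const_sub U)).mul (hp j u)).add (h1 u)
      refine h.congr_deriv ?_
      simp only [Function.comp_apply]
      ring
    · simp only [sub_self, h3]
      rw [zero_pow (by omega), show i + (j + 1) + 1 = i + 1 + j + 1 by omega]
      simp

end BetaIntegral

/-! ### The 2-holonomy along `P_V` -/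

namespace KZGenerators

open Set MeasureTheory Filter Topology

section Path

variable {ε s r : ℝ} {a : ℂ}

/-- Germs in `r` and in `s` are both needed, since the integrand differentiates the 2-path in both
variables. Here the germ in `s` is constant, which kills the integrand. -/
lemma PV_eventuallyEq_left (hr : r < s / 2) :
    (PV ε a s =ᶠ[𝓝 r] pLeft ε a) ∧ (fun s' => PV ε a s' r) =ᶠ[𝓝 s] fun _ => pLeft ε a r := by
  constructor
  · filter_upwards [eventually_lt_nhds hr] with x hx
    simp only [PV, if_pos hx.le]
  · filter_upwards [eventually_gt_nhds (show 2 * r < s by linarith)] with x hx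
    have : r ≤ x / 2 := by linarith
    simp only [PV, if_pos this]

/-- The vertical segment of `P_V(s, ·)`. -/
noncomputable def pVert (ε : ℝ) (a : ℂ) (s r : ℝ) : ℂ × ℂ :=
  (cVι ε s, (1 - cI ε (2 * r - s) : ℂ) / (1 - ε : ℂ) * a)

lemma PV_eventuallyEq_vert (hr : s / 2 < r) (hr' : r < s) :
    (PV ε a s =ᶠ[𝓝 r] pVert ε a s) ∧
      (fun s' => PV ε a s' r) =ᶠ[𝓝 s] fun s' => pVert ε a s' r := by
  constructor
  · filter_upwards [eventually_gt_nhds hr, eventually_lt_nhds hr'] with x hx hx'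
    simp only [PV, if_neg hx.not_ge, if_pos hx'.le, pVert]
  · filter_upwards [eventually_lt_nhds (show s < 2 * r by linarith),
      eventually_gt_nhds hr'] with x hx hx'
    have : ¬ r ≤ x / 2 := by linarith
    simp only [PV, if_neg this, if_pos hx'.le, pVert]

lemma PV_eventuallyEq_right (hs : 0 ≤ s) (hr : s < r) :
    (PV ε a s =ᶠ[𝓝 r] pV ε a) ∧ (fun s' => PV ε a s' r) =ᶠ[𝓝 s] fun _ => pV ε a r := by
  constructor
  · filter_upwards [eventually_gt_nhds hr] with x hx
    have : ¬ x ≤ s / 2 := by linarith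
    simp only [PV, if_neg this, if_neg hx.not_ge]
  · filter_upwards [eventually_lt_nhds hr,
      eventually_lt_nhds (show s < 2 * r by linarith)] with x hx hx'
    have : ¬ r ≤ x / 2 := by linarith
    simp only [PV, if_neg this, if_neg hx.not_ge]

lemma hasDerivAt_pVert (ε : ℝ) (a : ℂ) (s r : ℝ) :
    HasDerivAt (pVert ε a s) (0, -(2 * (1 - 2 * ε)) / (1 - ε) * a) r := by
  refine (hasDerivAt_const _ _).prodMk ?_
  have h := (hasDerivAt_one_sub_cI ε (2 * r - s)).scomp r
    (((hasDerivAt_id r).const_mul 2).sub_const s)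
  refine ((h.div_const _).mul_const a).congr_deriv ?_
  simp only [mul_one, Complex.real_smul, Complex.ofReal_ofNat]
  ring

/-- The `v`-component `y` can stay unspecified: the derivative in `r` is purely vertical, so `dz ∧
dv` does not see it. -/
lemma hasDerivAt_pVert_param (hε : 0 < ε) (hε' : ε ≤ 1 / 4) (hs : s ∈ Icc (0 : ℝ) 1) (a : ℂ)
    (r : ℝ) : ∃ y, HasDerivAt (fun s' => pVert ε a s' r) (deriv (cVι ε) s, y) s := by
  have h := (hasDerivAt_one_sub_cI ε (2 * r - s)).scomp s ((hasDerivAt_id s).const_sub (2 * r))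
  exact ⟨_, ((hasDerivAt_cVι hε hε' hs).differentiableAt.hasDerivAt).prodMk
    ((h.div_const _).mul_const a)⟩

lemma vert_div (hε : 0 < ε) (hε' : ε ≤ 1 / 4) (ha : a ≠ 0) (hr : 2 * r - s ∈ Icc (0 : ℝ) 1) :
    -(2 * (1 - 2 * ε) : ℂ) / (1 - ε) * a / ((1 - cI ε (2 * r - s) : ℂ) / (1 - ε : ℂ) * a) =
      2 * coeff ε 1 (2 * r - s) := by
  have h1 := one_sub_cI_ne_zero hε hε' hr
  have h3 : (1 - ε : ℂ) ≠ 0 := by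
    have : 1 - ε ≠ 0 := by linarith
    exact_mod_cast this
  simp only [coeff, Ω, Fin.val_one, Nat.cast_one]
  rw [← neg_sub (1 : ℂ) (cI ε (2 * r - s))]
  field_simp

end Path

variable {A M : Type*} [Ring A] [Algebra ℂ A] [AddCommGroup M] [Module ℂ M] [Module A M]
  [Module Aᵐᵒᵖ M] (D : KZGenerators A M) {ε s r : ℝ} {a : ℂ}

/-! ### Transport along the three segments of a cross-sectional path -/

section Vertical

/-- The connection along the cross-sectional path of `P_V`. -/
noncomputable def formPV (ε : ℝ) (a : ℂ) (s r : ℝ) : A :=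
  D.nabla (PV ε a s r) (deriv (PV ε a s) r)

lemma formPV_left (hε : 0 < ε) (hε' : ε ≤ 1 / 4) (hs : s ≤ 1) (hr : 0 < r) (hr' : r < s / 2) :
    D.formPV ε a s r = (2 : ℂ) • D.formLeft ε (2 * r) := by
  have h := (PV_eventuallyEq_left (ε := ε) (a := a) hr').1
  rw [formPV, h.deriv_eq, h.eq_of_nhds]
  exact D.nabla_pLeft hε hε' ⟨by linarith, by linarith⟩

lemma formPV_vert (hε : 0 < ε) (hε' : ε ≤ 1 / 4) (ha : a ≠ 0) (hs : s ≤ 1) (hr : s / 2 < r)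
    (hr' : r < s) : D.formPV ε a s r = (2 * coeff ε 1 (2 * r - s)) • D.Λ := by
  have h := (PV_eventuallyEq_vert (ε := ε) (a := a) hr hr').1
  rw [formPV, h.deriv_eq, h.eq_of_nhds, (hasDerivAt_pVert ε a s r).deriv, nabla,
    ← vert_div hε hε' ha ⟨by linarith, by linarith⟩]
  simp [Γ, pVert]

lemma formPV_right (hε : 0 < ε) (hε' : ε ≤ 1 / 4) (ha : a ≠ 0) (hs : 0 ≤ s) (hr : s < r)
    (hr' : r < 1) : D.formPV ε a s r = D.formV ε r := by
  have h := (PV_eventuallyEq_right (ε := ε) (a := a) hs hr).1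
  rw [formPV, h.deriv_eq, h.eq_of_nhds]
  exact D.nabla_pV hε hε' ha ⟨by linarith, by linarith⟩

lemma hasDerivWithinAt_logV_vert (hε : 0 < ε) (hε' : ε ≤ 1 / 4) (hs : s ∈ Icc (0 : ℝ) 1) :
    ∀ r ∈ Icc (s / 2) s, HasDerivWithinAt (fun r => logV ε (2 * r - s))
      (2 * coeff ε 1 (2 * r - s)) (Icc (s / 2) s) r := by
  intro r hr
  have h := (hasDerivAt_logV hε hε' (s := 2 * r - s)
    ⟨by linarith [hr.1], by linarith [hr.2, hs.2]⟩).scomp r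
      (((hasDerivAt_id r).const_mul 2).sub_const s)
  refine (h.congr_deriv ?_).hasDerivWithinAt
  simp

lemma continuousOn_coeff_vert (hε : 0 < ε) (hε' : ε ≤ 1 / 4) (hs : s ∈ Icc (0 : ℝ) 1) :
    ContinuousOn (fun r => 2 * coeff ε 1 (2 * r - s)) (Icc (s / 2) s) :=
  continuousOn_const.mul ((continuousOn_coeff hε hε' 1).comp (by fun_prop)
    fun r hr => ⟨by linarith [hr.1], by linarith [hr.2, hs.2]⟩)

/-- The exponential series of `ħ z Λ`. -/
noncomputable def expΛ (z : ℂ) (n : ℕ) : A := (z ^ n / n.factorial) • D.Λ ^ n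

lemma formalTransport_vert (hε : 0 < ε) (hε' : ε ≤ 1 / 4) (ha : a ≠ 0) (hs : s ∈ Icc (0 : ℝ) 1)
    {x y : ℝ} (hx : x ∈ Icc (s / 2) s) (hy : y ∈ Icc (s / 2) s) :
    formalTransport (D.formPV ε a s) x y =
        D.expΛ (logV ε (2 * y - s) - logV ε (2 * x - s)) ∧
      Transportable (D.formPV ε a s) x y := by
  have hlt : ∀ r ∈ uIoo x y, s / 2 < r ∧ r < s := fun r hr =>
    ⟨(le_inf hx.1 hy.1).trans_lt hr.1, hr.2.trans_le (sup_le hx.2 hy.2)⟩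
  have he : EqOn (fun r => (2 * coeff ε 1 (2 * r - s)) • D.Λ) (D.formPV ε a s) (uIoo x y) :=
    fun r hr => (D.formPV_vert hε hε' ha hs.2 (hlt r hr).1 (hlt r hr).2).symm
  constructor
  · funext n
    rw [← formalTransport_congr he n y right_mem_uIcc]
    exact formalTransport_smul_const (hasDerivWithinAt_logV_vert hε hε' hs)
      (continuousOn_coeff_vert hε hε' hs) hx n y hy
  · exact ((TameOn.smul _ _ (continuousOn_coeff_vert hε hε' hs)).transportable hx hy).congr he

lemma formalTransport_left (hε : 0 < ε) (hε' : ε ≤ 1 / 4) (hs : s ∈ Icc (0 : ℝ) 1) :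
    formalTransport (D.formPV ε a s) 0 (s / 2) = formalTransport (D.formLeft ε) 0 s ∧
      Transportable (D.formPV ε a s) 0 (s / 2) := by
  have h0 : 0 ≤ s / 2 := by linarith [hs.1]
  have he : EqOn (fun r => (2 : ℂ) • D.formLeft ε (2 * r)) (D.formPV ε a s) (uIoo 0 (s / 2)) := by
    intro r hr
    rw [uIoo_of_le h0] at hr
    exact (D.formPV_left hε hε' hs.2 hr.1 hr.2).symm
  constructor
  · funext n
    rw [← formalTransport_congr he n _ right_mem_uIcc,
      (D.tameOn_formLeft hε hε').formalTransport_comp_two_mul n s hs]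
  · refine (TameOn.transportable (a := 0) (b := s / 2) ?_ ⟨le_rfl, h0⟩ ⟨h0, le_rfl⟩).congr he
    exact ((D.tameOn_formLeft hε hε').comp (by fun_prop)
      fun r hr => ⟨by linarith [hr.1], by linarith [hr.2, hs.2]⟩).const_smul 2

lemma formalTransport_right (hε : 0 < ε) (hε' : ε ≤ 1 / 4) (ha : a ≠ 0)
    (hs : s ∈ Icc (0 : ℝ) 1) :
    formalTransport (D.formPV ε a s) s 1 = formalTransport (D.formV ε) s 1 ∧
      Transportable (D.formPV ε a s) s 1 := by
  have he : EqOn (D.formV ε) (D.formPV ε a s) (uIoo s 1) := by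
    intro r hr
    rw [uIoo_of_le hs.2] at hr
    exact (D.formPV_right hε hε' ha hs.1 hr.1 hr.2).symm
  constructor
  · funext n
    rw [← formalTransport_congr he n _ right_mem_uIcc]
  · exact ((D.tameOn_formV hε hε').transportable hs ⟨zero_le_one, le_rfl⟩).congr he

lemma transport_PV_start (hε : 0 < ε) (hε' : ε ≤ 1 / 4) (ha : a ≠ 0) (hs : s ∈ Icc (0 : ℝ) 1)
    (hr : r ∈ Icc (s / 2) s) : D.transport (PV ε a s) 0 r =
      conv (LinearMap.mul ℂ A) (D.expΛ (logV ε (2 * r - s)))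
        (formalTransport (D.formLeft ε) 0 s) := by
  have hl : s / 2 ∈ Icc (s / 2) s := ⟨le_rfl, by linarith [hs.1]⟩
  obtain ⟨h1, h1'⟩ := D.formalTransport_left (a := a) hε hε' hs
  obtain ⟨h2, h2'⟩ := D.formalTransport_vert hε hε' ha hs hl hr
  -- The vertical segment begins at `r = s/2`, where `2r - s = 0` and the logarithm vanishes.
  rw [mul_div_cancel₀ s two_ne_zero, sub_self, logV_zero hε', sub_zero] at h2
  funext n
  rw [← h1, ← h2]
  exact formalTransport_comp h1' h2' n r right_mem_uIcc

lemma transport_PV_end (hε : 0 < ε) (hε' : ε ≤ 1 / 4) (ha : a ≠ 0) (hs : s ∈ Icc (0 : ℝ) 1)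
    (hr : r ∈ Icc (s / 2) s) : D.transport (PV ε a s) r 1 =
      conv (LinearMap.mul ℂ A) (formalTransport (D.formV ε) s 1)
        (D.expΛ (logV ε s - logV ε (2 * r - s))) := by
  have hl : s ∈ Icc (s / 2) s := ⟨by linarith [hs.1], le_rfl⟩
  obtain ⟨h1, h1'⟩ := D.formalTransport_right (a := a) hε hε' ha hs
  obtain ⟨h2, h2'⟩ := D.formalTransport_vert hε hε' ha hs hr hl
  rw [show 2 * s - s = s by ring] at h2
  funext n
  rw [← h1, ← h2]
  exact formalTransport_comp h2' h1' n 1 right_mem_uIcc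

end Vertical

variable [IsScalarTower ℂ A M] [IsScalarTower ℂ Aᵐᵒᵖ M]

/-- The pullback along `c_V ∘ ι` of the `M`-valued 1-form `(L / z + R / (z - 1)) dz`. -/
noncomputable def formLR (ε s : ℝ) : M :=
  deriv (cVι ε) s • ((1 / cVι ε s) • D.L + (1 / (cVι ε s - 1)) • D.R)

lemma formLR_eq (hε : 0 < ε) (hε' : ε ≤ 1 / 4) (hs : s ∈ Icc (0 : ℝ) 1) :
    D.formLR ε s = coeff ε 0 s • D.L - coeff ε 1 s • (D.L + D.R) := by
  obtain ⟨h1, h2⟩ := cVι_div hε hε' hs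
  rw [formLR, smul_add, smul_smul, smul_smul, mul_one_div, mul_one_div, h1, h2]
  module

lemma odeSource_zero : D.odeSource ε s 0 = 0 := by
  simp [odeSource]

lemma deriv_smul_odeSource_succ (k : ℕ) : deriv (cVι ε) s • D.odeSource ε s (k + 1) =
    (logV ε s ^ k / (k.factorial : ℂ)) •
      ∑ j ∈ Finset.range k, D.sandwichLin j (k - 1 - j) (D.formLR ε s) := by
  rw [odeSource_succ, smul_comm, Finset.smul_sum]
  simp only [sandwich_eq, formLR, map_smul]

lemma tameOn_odeSource (hε : 0 < ε) (hε' : ε ≤ 1 / 4) (n : ℕ) :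
    TameOn (Icc 0 1) (fun s => (deriv (cVι ε) s • D.odeSource ε s) n) := by
  simp only [Pi.smul_apply]
  rcases n with _ | k
  · simpa [odeSource_zero] using TameOn.const (0 : M)
  simp only [deriv_smul_odeSource_succ]
  have hc : ContinuousOn (logV ε) (Icc 0 1) := fun s hs =>
    (hasDerivAt_logV hε hε' hs).continuousAt.continuousWithinAt
  refine TameOn.fun_smul ((hc.pow k).div_const _) (.sum _ fun j _ => .map _ ?_)
  refine TameOn.congr (φ := fun s => coeff ε 0 s • D.L + coeff ε 1 s • -(D.L + D.R))
    (.add (.smul _ _ (continuousOn_coeff hε hε' 0)) (.smul _ _ (continuousOn_coeff hε hε' 1)))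
    fun s hs => ?_
  simp only [D.formLR_eq hε hε' hs, smul_neg, sub_eq_add_neg]

/-! ### The conjugated ODE -/

section Equation

variable [SMulCommClass A Aᵐᵒᵖ M]

/-- `W_{0s} m W_{s0}`, the transports being those along `p_V` and `c_V ∘ ι`. -/
noncomputable def conjTransport (ε s : ℝ) (m : ℕ → M) : ℕ → M :=
  conv (rightAction A M) (conv (leftAction A M) (formalTransport (D.formV ε) s 0) m)
    (formalTransport (D.formLeft ε) 0 s)

/-- Variation of constants: differentiating the left transport cancels `formV f`, differentiating
the right one cancels `-f formLeft`, and only the conjugated source survives. -/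
lemma tameDeriv_conjTransport_fV (hε : 0 < ε) (hε' : ε ≤ 1 / 4) (n : ℕ) :
    TameDeriv (Icc 0 1) (fun s => D.conjTransport ε s (D.fV ε s) n)
      (fun s => D.conjTransport ε s (deriv (cVι ε) s • D.odeSource ε s) n) := by
  have h0 : (0 : ℝ) ∈ Icc (0 : ℝ) 1 := ⟨le_rfl, zero_le_one⟩
  have h := TameDeriv.convolution (rightAction A M)
    (TameDeriv.convolution (leftAction A M)
      ((D.tameOn_formV hε hε').formalTransport_deriv_source h0) (D.tameDeriv_fV hε hε'))
    ((D.tameOn_formLeft hε hε').formalTransport_deriv h0) n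
  refine h.congr (fun _ _ => rfl) fun s _ => ?_
  simp only [conjTransport]
  refine congrFun ?_ n
  change conv (rightAction A M) (conv (leftAction A M) (-conv (LinearMap.mul ℂ A)
    (formalTransport (D.formV ε) s 0) (Pi.single 1 (D.formV ε s))) (D.fV ε s) +
    conv (leftAction A M) (formalTransport (D.formV ε) s 0)
    (conv (leftAction A M) (Pi.single 1 (D.formV ε s)) (D.fV ε s) -
        conv (rightAction A M) (D.fV ε s) (Pi.single 1 (D.formLeft ε s)) +
        deriv (cVι ε) s • D.odeSource ε s)) (formalTransport (D.formLeft ε) 0 s) +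
    conv (rightAction A M) (conv (leftAction A M) (formalTransport (D.formV ε) s 0) (D.fV ε s))
      (conv (LinearMap.mul ℂ A) (Pi.single 1 (D.formLeft ε s))
        (formalTransport (D.formLeft ε) 0 s)) = _
  rw [← conv_rightAction_mul, conv_leftAction_rightAction _ _ (Pi.single 1 _), conv_neg_left,
    conv_leftAction_mul]
  simp only [conv_add_left, conv_add_right, conv_sub_left, conv_sub_right, conv_neg_left]
  abel

lemma tameOn_conjTransport_odeSource (hε : 0 < ε) (hε' : ε ≤ 1 / 4) (n : ℕ) :
    TameOn (Icc 0 1)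
      (fun s => D.conjTransport ε s (deriv (cVι ε) s • D.odeSource ε s) n) := by
  have h0 : (0 : ℝ) ∈ Icc (0 : ℝ) 1 := ⟨le_rfl, zero_le_one⟩
  exact TameOn.convolution _ (TameOn.convolution _
    (fun n => ((D.tameOn_formV hε hε').formalTransport_deriv_source h0 n).tameOn)
    (D.tameOn_odeSource hε hε')) ((D.tameOn_formLeft hε hε').tameOn_formalTransport h0) n

lemma solvesODE_fV (hε : 0 < ε) (hε' : ε ≤ 1 / 4) (ha : a ≠ 0) :
    D.SolvesODE ε a (D.fV ε) := by
  have h0 : (0 : ℝ) ∈ Icc (0 : ℝ) 1 := ⟨le_rfl, zero_le_one⟩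
  intro n s hs
  refine ((D.tameDeriv_conjTransport_fV hε hε' n).congr (fun r hr => ?_)
    (ψ' := fun s => deriv (cVι ε) s • rightMul (leftMul (D.transport (pV ε a) s 0)
      (D.odeSource ε s)) (D.transport (pLeft ε a) 0 (s / 2)) n)
    (fun r hr => ?_)).hasWeakDerivWithinAt hs
  · simp only [D.transport_pV hε hε' ha hr h0, D.transport_pLeft hε hε' hr]
    rfl
  · simp only [D.transport_pV hε hε' ha hr h0, D.transport_pLeft hε hε' hr, leftMul_eq,
      rightMul_eq, conjTransport, conv_smul_left, conv_smul_right, Pi.smul_apply]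

end Equation

/-! ### The inner and outer integrals of the 2-holonomy -/

section Holonomy

variable [SMulCommClass A Aᵐᵒᵖ M]

/-- Expanding both exponentials of `Λ` gives the terms `Λ^i m Λ^j` with scalar factor `(U - u)^i /
i! · u^j / j! · du`, where `u` runs from `0` to `U = logV ε s` and `2 * coeff` is `du/dr`. The beta
integral depends only on `i + j`, which yields the sum over `j` in the source. -/
lemma hasWeakIntegral_vert (hε : 0 < ε) (hε' : ε ≤ 1 / 4) (hs : s ∈ Icc (0 : ℝ) 1) (n : ℕ) :
    HasWeakIntegral (fun r => conv (rightAction A M)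
      (conv (leftAction A M) (D.expΛ (logV ε s - logV ε (2 * r - s)))
        (Pi.single 2 ((2 * coeff ε 1 (2 * r - s)) • D.formLR ε s)))
      (D.expΛ (logV ε (2 * r - s))) n) (s / 2) s ((deriv (cVι ε) s • D.odeSource ε s) n) := by
  rcases n with _ | _ | n
  -- Degrees `0` and `1` vanish on the left because `Δ` carries `ħ²`. Degree `n + 2` corresponds to
  -- `k = n + 1` in the source.
  · simpa [conv_apply_zero, conv_single_two_right, odeSource_zero] using HasWeakIntegral.zero
  · have h : D.odeSource ε s 1 = 0 := by simp [D.odeSource_succ]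
    simpa [conv_zero_left_succ, conv_apply_zero, (conv_single_two_right _ _ _).1,
      (conv_single_two_right _ _ _).2.1, h] using HasWeakIntegral.zero
  have hK : ∀ r, conv (rightAction A M)
      (conv (leftAction A M) (D.expΛ (logV ε s - logV ε (2 * r - s)))
        (Pi.single 2 ((2 * coeff ε 1 (2 * r - s)) • D.formLR ε s)))
      (D.expΛ (logV ε (2 * r - s))) (n + 2) =
      ∑ p ∈ Finset.HasAntidiagonal.antidiagonal n,
        (2 * coeff ε 1 (2 * r - s) * ((logV ε s - logV ε (2 * r - s)) ^ p.1 / p.1.factorial *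
          (logV ε (2 * r - s) ^ p.2 / p.2.factorial))) •
            D.sandwichLin p.1 p.2 (D.formLR ε s) := by
    intro r
    rw [conv_zero_left_succ _ _ (conv_single_two_right _ _ _).1,
      conv_zero_left_succ _ _ (conv_single_two_right _ _ _).2.1, conv]
    refine Finset.sum_congr rfl fun p _ => ?_
    rw [(conv_single_two_right _ _ _).2.2]
    simp only [expΛ, map_smul, LinearMap.smul_apply, leftAction_apply, rightAction_apply,
      sandwichLin, LinearMap.comp_apply, LinearMap.flip_apply, smul_smul,
      smul_comm (D.Λ ^ p.1) (MulOpposite.op (D.Λ ^ p.2))]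
    congr 1
    ring
  have hR : (deriv (cVι ε) s • D.odeSource ε s) (n + 2) =
      ∑ p ∈ Finset.HasAntidiagonal.antidiagonal n,
        (logV ε s ^ (p.1 + p.2 + 1) / (p.1 + p.2 + 1).factorial) •
          D.sandwichLin p.1 p.2 (D.formLR ε s) := by
    rw [Pi.smul_apply, deriv_smul_odeSource_succ, Finset.smul_sum,
      Finset.Nat.sum_antidiagonal_eq_sum_range_succ_mk]
    refine Finset.sum_congr rfl fun j hj => ?_
    have hj' : j + (n - j) = n := by
      have := Finset.mem_range.1 hj
      omega
    simp only [hj', Nat.add_sub_cancel]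
  simp only [hK, hR]
  refine .sum _ fun p _ => ?_
  obtain ⟨G, h1, h2, h3⟩ := exists_antideriv_beta (logV ε s) p.1 p.2
  have hu := hasDerivWithinAt_logV_vert hε hε' hs
  have huc : ContinuousOn (fun r => logV ε (2 * r - s)) (Icc (s / 2) s) :=
    fun r hr => (hu r hr).continuousWithinAt
  have hl : s / 2 ≤ s := by linarith [hs.1]
  have hd := TameDeriv.smul (fun r => G (logV ε (2 * r - s))) _
    (D.sandwichLin p.1 p.2 (D.formLR ε s)) fun r hr => (h1 _).scomp_hasDerivWithinAt r (hu r hr)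
  have ht := hd.hasWeakIntegral (.smul _ _ ((continuousOn_coeff_vert hε hε' hs).mul
    ((((continuousOn_const.sub huc).pow _).div_const _).mul ((huc.pow _).div_const _))))
    ⟨le_rfl, hl⟩ ⟨hl, le_rfl⟩
  rw [mul_div_cancel₀ s two_ne_zero, sub_self, logV_zero hε', h2,
    show 2 * s - s = s by ring, h3, zero_smul, sub_zero] at ht
  exact ht

lemma Delta_zero_left (q X : ℂ × ℂ) : D.Delta q 0 X = 0 := by
  simp [Delta, dzdv]

/-- The factor `2` of `Δ` cancels the `1/2` in `dz ∧ dv`, leaving the product of the pullback of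
`(L/z + R/(z-1)) dz` in `s` and of `dv/v` in `r`. -/
lemma Delta_PV_vert (hε : 0 < ε) (hε' : ε ≤ 1 / 4) (ha : a ≠ 0) (hs : s ∈ Icc (0 : ℝ) 1)
    (hr : s / 2 < r) (hr' : r < s) :
    D.Delta (PV ε a s r) (deriv (fun s' => PV ε a s' r) s) (deriv (PV ε a s) r) =
      (2 * coeff ε 1 (2 * r - s)) • D.formLR ε s := by
  obtain ⟨h1, h2⟩ := PV_eventuallyEq_vert (ε := ε) (a := a) hr hr'
  obtain ⟨y, hy⟩ := hasDerivAt_pVert_param hε hε' hs a r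
  rw [h1.deriv_eq, h2.deriv_eq, h1.eq_of_nhds, (hasDerivAt_pVert ε a s r).deriv, hy.deriv,
    ← vert_div hε hε' ha ⟨by linarith, by linarith [hs.2]⟩, formLR, Delta, dzdv]
  simp only [pVert, smul_add, smul_smul]
  congr 2
  all_goals
    simp only [mul_inv, div_eq_mul_inv]
    ring

lemma holIntegrand_eq_zero {P : ℝ → ℝ → ℂ × ℂ} (h : deriv (fun s' => P s' r) s = 0) :
    D.holIntegrand P s r = 0 := by
  rw [holIntegrand, h, Delta_zero_left, Pi.single_zero]
  funext n
  simp [rightMul, leftMul]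

lemma hasWeakIntegral_holIntegrand (hε : 0 < ε) (hε' : ε ≤ 1 / 4) (ha : a ≠ 0)
    (hs : s ∈ Icc (0 : ℝ) 1) (n : ℕ) :
    HasWeakIntegral (fun r => D.holIntegrand (PV ε a) s r n) 0 1
      (conv (leftAction A M) (formalTransport (D.formV ε) 0 1)
        (D.conjTransport ε s (deriv (cVι ε) s • D.odeSource ε s)) n) := by
  have h1 : HasWeakIntegral (fun r => D.holIntegrand (PV ε a) s r n) 0 (s / 2) 0 := by
    refine HasWeakIntegral.zero.congr fun r hr => ?_
    rw [uIoo_of_le (by linarith [hs.1])] at hr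
    simp [D.holIntegrand_eq_zero (((PV_eventuallyEq_left hr.2).2.deriv_eq).trans (deriv_const _ _))]
  have h3 : HasWeakIntegral (fun r => D.holIntegrand (PV ε a) s r n) s 1 0 := by
    refine HasWeakIntegral.zero.congr fun r hr => ?_
    rw [uIoo_of_le hs.2] at hr
    simp [D.holIntegrand_eq_zero
      (((PV_eventuallyEq_right hs.1 hr.1).2.deriv_eq).trans (deriv_const _ _))]
  have h2 := (HasWeakIntegral.conv_left (rightAction A M) (formalTransport (D.formLeft ε) 0 s)
    (HasWeakIntegral.conv_right (leftAction A M) (formalTransport (D.formV ε) s 1)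
      (D.hasWeakIntegral_vert hε hε' hs)) n).congr
    (ψ := fun r => D.holIntegrand (PV ε a) s r n) fun r hr => by
      rw [uIoo_of_le (by linarith [hs.1])] at hr
      have hr' : r ∈ Icc (s / 2) s := ⟨hr.1.le, hr.2.le⟩
      simp only [holIntegrand]
      rw [D.Delta_PV_vert hε hε' ha hs hr.1 hr.2, D.transport_PV_start hε hε' ha hs hr',
        D.transport_PV_end hε hε' ha hs hr', leftMul_eq, rightMul_eq, conv_leftAction_mul,
        ← conv_rightAction_mul, ← conv_leftAction_rightAction]
  have h := (h1.trans h2).trans h3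
  rw [zero_add, add_zero] at h
  convert h using 1
  have h0 : (0 : ℝ) ∈ Icc (0 : ℝ) 1 := ⟨le_rfl, zero_le_one⟩
  have h01 : (1 : ℝ) ∈ Icc (0 : ℝ) 1 := ⟨zero_le_one, le_rfl⟩
  -- `W_{1s} = W_{10} W_{0s}` along `p_V` isolates the factor independent of `s`, so that the outer
  -- integrand is a fixed multiple of a known derivative.
  have hc : formalTransport (D.formV ε) s 1 = conv (LinearMap.mul ℂ A)
      (formalTransport (D.formV ε) 0 1) (formalTransport (D.formV ε) s 0) := by
    funext m
    exact formalTransport_comp ((D.tameOn_formV hε hε').transportable hs h0)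
      ((D.tameOn_formV hε hε').transportable h0 h01) m 1 right_mem_uIcc
  rw [hc, conv_leftAction_mul, conv_leftAction_rightAction, conjTransport]

/-- The outer integrand is `W_{10}` times the derivative of the conjugate of `f_V`. The boundary
term at `0` vanishes with `f_V(0)`, and at `1` the product `W_{10} W_{01} = 1` leaves `f_V(1)` times
the right transport. -/
lemma hasWeakIntegral_twoHolonomy (hε : 0 < ε) (hε' : ε ≤ 1 / 4) (ha : a ≠ 0) (n : ℕ) :
    HasWeakIntegral (fun s => weakIntegral (fun r => D.holIntegrand (PV ε a) s r n) 0 1) 0 1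
      (rightMul (D.fV ε 1) (D.transportΓ (cVι ε) 0 1) n) := by
  have h0 : (0 : ℝ) ∈ Icc (0 : ℝ) 1 := ⟨le_rfl, zero_le_one⟩
  have h1 : (1 : ℝ) ∈ Icc (0 : ℝ) 1 := ⟨zero_le_one, le_rfl⟩
  have h := HasWeakIntegral.conv_right (leftAction A M) (formalTransport (D.formV ε) 0 1)
    (I := D.conjTransport ε 1 (D.fV ε 1)) (a := 0) (b := 1)
    (y := fun s => D.conjTransport ε s (deriv (cVι ε) s • D.odeSource ε s)) (fun n => by
      have := (D.tameDeriv_conjTransport_fV hε hε' n).hasWeakIntegral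
        (D.tameOn_conjTransport_odeSource hε hε' n) h0 h1
      have hz : D.conjTransport ε 0 (D.fV ε 0) n = 0 := by
        rw [fV_start]
        simp [conjTransport, conv]
      rwa [hz, sub_zero] at this) n
  convert h.congr fun s hs => ?_ using 1
  · rw [D.transportΓ_cVι hε hε' h0 h1, conjTransport, ← conv_leftAction_rightAction,
      ← conv_leftAction_mul, (D.tameOn_formV hε hε').formalTransport_inv h1 h0,
      conv_leftAction_one]
    rfl
  · exact (D.hasWeakIntegral_holIntegrand hε hε' ha (uIoo_subset_Icc h0 h1 hs) n).eq.symm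

lemma holIntegrable_PV (hε : 0 < ε) (hε' : ε ≤ 1 / 4) (ha : a ≠ 0) :
    D.HolIntegrable (PV ε a) := fun n =>
  ⟨fun _ hs => ⟨_, D.hasWeakIntegral_holIntegrand hε hε' ha hs n⟩,
    ⟨_, D.hasWeakIntegral_twoHolonomy hε hε' ha n⟩⟩

lemma twoHolonomy_PV (hε : 0 < ε) (hε' : ε ≤ 1 / 4) (ha : a ≠ 0) :
    D.twoHolonomy (PV ε a) = rightMul (D.fV ε 1) (D.transportΓ (cVι ε) 0 1) := by
  funext n
  exact (D.hasWeakIntegral_twoHolonomy hε hε' ha n).eq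

end Holonomy

end KZGenerators

/-! ### Whiskering makes modification components a bimodule over the pseudonatural endomorphisms -/

section Whiskering

variable {C : Type u} [Category.{v} C] [Preadditive C] [Linear ℂ C]
  [ChCategory.{v, u, w} C] [MonoidalCategory C] [MonoidalPreadditive C] [MonoidalLinear ℂ C]
  [SymmetricCategory C] [ChSymmetricMonoidal C]

instance : IsScalarTower ℂ (PsNat C) (ModFam C) where
  smul_assoc c θ Ξ := by
    funext X Y Z
    exact map_smul (post (Ξ X Y Z)) c (θ.1.1 X Y Z)

instance : IsScalarTower ℂ (PsNat C)ᵐᵒᵖ (ModFam C) where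
  smul_assoc c θ Ξ := by
    funext X Y Z
    exact LinearMap.map_smul₂ pre c (θ.unop.1.1 X Y Z) (Ξ X Y Z)

instance : SMulCommClass (PsNat C) (PsNat C)ᵐᵒᵖ (ModFam C) where
  smul_comm θ ξ Ξ := by
    funext X Y Z
    exact (pre_post (ξ.unop.1.1 X Y Z) (Ξ X Y Z) (θ.1.1 X Y Z)).symm

end Whiskering

theorem mainTheorem3 {C : Type u} [Category.{v} C] [Preadditive C] [Linear ℂ C]
    [ChCategory.{v, u, w} C] [MonoidalCategory C] [MonoidalPreadditive C] [MonoidalLinear ℂ C]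
    [SymmetricCategory C] [ChSymmetricMonoidal C]
    (t : Inf2Braiding C) (hsymm : t.IsSymmetric) (hstrict : t.IsStrict)
    (ε : ℝ) (hε : 0 < ε) (hε' : ε ≤ 1 / 4) (a : ℂ) (ha : a ≠ 0) :
    t.generators.HolIntegrable (PV ε a) ∧
    t.generators.fV ε 0 = 0 ∧
    t.generators.SolvesODE ε a (t.generators.fV ε) ∧
    t.generators.twoHolonomy (PV ε a) =
      rightMul (t.generators.fV ε 1) (t.generators.transportΓ (cVι ε) 0 1) :=
  ⟨t.generators.holIntegrable_PV hε hε' ha, t.generators.fV_start,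
    t.generators.solvesODE_fV hε hε' ha, t.generators.twoHolonomy_PV hε hε' ha⟩
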